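/- **Setting.** Let $\mathfrak{Comp}$ be the category of compact metric spaces with isometric embeddings as morphisms. Let $\mathfrak{Pos}$ be the category of posets with order-preserving maps, and let $\mathfrak{Pos_m}$ be the category of extended metric spaces $A$ (distance $\infty$ allowed) with a partial order such that $\{a'\in A: a'\le a\}$ is compact for every $a\in A$, with order-preserving isometric embeddings as morphisms. Let $\tau:\mathfrak{Comp}\to\mathfrak{Pos_m}$ be a functor, $f\mapsto \tau_f$, such that for every isometry $f:X\to X$ of a compact metric space onto itself and every $a\in\tau(X)$, $\tau_f(a)\le a$ implies $\tau_f(a)=a$. Let $\tau^t$ be a contravariant functor from $\mathfrak{Comp}$ to $\mathfrak{Pos}$ (truncation) with $\tau^t(X)=\tau(X)$ as posets and, for every morphism $f:X\to Y$, $a\in\tau(X)$, $b\in\tau(Y)$, $$\tau^t_f(\tau_f(a))=a,\qquad \tau_f(\tau^t_f(b))\le b .$$ A metric space is *boundedly compact* if its closed balls are compact. For such $X$ let $\varphi(X)$ be the set of families $(a_Y)_Y$, indexed by the compact subsets $Y\subseteq X$, with $a_Y\in\tau(Y)$ and $\tau^t_\iota(a_{Y'})=a_Y$ whenever $Y\subseteq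 Y'$ with inclusion $\iota$. Let $\mathcal C'$ be the set of isomorphism classes of tuples $\mathcal X=(X,o;a)$, where $X$ is boundedly compact, $o\in X$ and $a\in\varphi(X)$; an isomorphism $(X,o;a)\to(X',o';a')$ is an isometry $e$ of $X$ onto $X'$ with $e(o)=o'$ and $\tau_{e|_Y}(a_Y)=a'_{e(Y)}$ for every compact $Y\subseteq X$, where $e|_Y:Y\to e(Y)$. Let $\mathcal C$ be the set of isomorphism classes of triples $(X,o;a)$ with $X$ compact, $o\in X$, $a\in\tau(X)$ (isomorphisms: isometries $e$ of $X$ onto $X'$ with $e(o)=o'$, $\tau_e(a)=a'$). A triple in $\mathcal C$ is identified with the tuple whose family consists of the truncations of $a$. With $\tau'(X):=X\times\tau(X)$ (max product metric), let $$d^c_{\tau'}\big((X,o;a),(Y,p;b)\big):=\inf_{Z,f,g}\ d_H(f(X),g(Y))\vee d(f(o),g(p))\vee d(\tau_f(a),\tau_g(b)),$$ the infimum being over all compact metric spaces $Z$ and all isometric embeddings $f:X\to Z$, $g:Y\to Z$; here $d_H$ is the Hausdorff distance. For a tuple $\mathcal X=(X,o;a)$ and $r\ge0$, let $\mathcal X^{(r)}:=(B_r,o;a_{B_r})$,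 where $B_r$ is the closed ball of radius $r$ centered at $o$. For $S'\subseteq S$ compact subsets of $X$ containing $o$, write $(S',o;a')\preceq(S,o;a'')$ if $a'\le\tau^t_\iota(a'')$, where $\iota:S'\hookrightarrow S$; write $(S',o;a')\preceq\mathcal X$ if $a'\le a_{S'}$. For $0<\epsilon\le1$ let $$a_\epsilon(\mathcal X,\mathcal Y):=\inf\{d^c_{\tau'}(\mathcal X^{(1/\epsilon)},\mathcal Y'):\ \mathcal Y'\text{ compact},\ \mathcal Y^{(1/\epsilon-\epsilon)}\preceq\mathcal Y'\preceq\mathcal Y\},$$ $$d(\mathcal X,\mathcal Y):=\inf\{\epsilon\in(0,1]:\ a_\epsilon(\mathcal X,\mathcal Y)\vee a_\epsilon(\mathcal Y,\mathcal X)<\epsilon/2\},\qquad \inf\emptyset:=1 .$$ **Assumptions.** 1. $\tau$ is pointwise-continuous: if $f,f_1,f_2,\ldots$ are isometric embeddings of a compact metric space $X$ into a compact metric space $Y$ and $f_n\to f$ pointwise, then $\tau_{f_n}\to\tau_f$ pointwise. 2. For all compact tuples $\mathcal X,\mathcal Y$ and every compact $\mathcal X'\preceq\mathcal X$ there exists a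 compact $\mathcal Y'\preceq\mathcal Y$ with $d^c_{\tau'}(\mathcal X',\mathcal Y')\le d^c_{\tau'}(\mathcal X,\mathcal Y)$. 3. In 2, if $\epsilon:=d^c_{\tau'}(\mathcal X,\mathcal Y)<\infty$, $r\ge2\epsilon$ and $\mathcal X^{(r)}\preceq\mathcal X'\preceq\mathcal X$, then $\mathcal Y'$ can be chosen such that also $\mathcal Y^{(r-2\epsilon)}\preceq\mathcal Y'\preceq\mathcal Y$. 4. If $Z,X,X_1,X_2,\ldots$ are compact metric spaces and $f:X\to Z$, $f_n:X_n\to Z$ are isometric embeddings with $d_H(f_n(X_n),f(X))\to0$, and if $b\in\tau(Z)$ and $a_n\in\tau(X_n)$ satisfy $\tau_{f_n}(a_n)\to b$, then $b\in\tau_f(\tau(X))$. **Theorem.** Under these assumptions, a subset $\mathcal A\subseteq\mathcal C'$ is relatively compact (its closure is compact) under $d$ if and only if for every $r\ge0$ the set $\mathcal A_r$ of the classes of the balls $\mathcal X^{(r)}$, $\mathcal X\in\mathcal A$, is relatively compact in $\mathcal C$ under $d^c_{\tau'}$. -/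

import Mathlib

open Set Filter Topology TopologicalSpace
open scoped NNReal ENNReal

universe u v

/-! ### Relative compactness with respect to a distance function -/

/-- The topology of a distance function `d`: a set is open if it contains a `d`-ball around each of
its points. When `d` is an (extended) metric, this is the metric topology. -/
@[reducible]
def distTopology {α : Type u} (d : α → α → ℝ≥0∞) : TopologicalSpace α where
  IsOpen s := ∀ x ∈ s, ∃ ε : ℝ≥0∞, 0 < ε ∧ ∀ y, d x y < ε → y ∈ s
  isOpen_univ := fun _ _ => ⟨1, one_pos, fun _ _ => mem_univ _⟩
  isOpen_inter := by
    rintro s t hs ht x ⟨hxs, hxt⟩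
    obtain ⟨ε, hε, h⟩ := hs x hxs
    obtain ⟨δ, hδ, h'⟩ := ht x hxt
    exact ⟨min ε δ, lt_min hε hδ, fun y hy =>
      ⟨h y (hy.trans_le (min_le_left _ _)), h' y (hy.trans_le (min_le_right _ _))⟩⟩
  isOpen_sUnion := by
    rintro S hS x ⟨s, hs, hx⟩
    obtain ⟨ε, hε, h⟩ := hS s hs x hx
    exact ⟨ε, hε, fun y hy => ⟨s, hs, h y hy⟩⟩

/-- `A` is relatively compact under `d`: its closure is compact. -/
def IsRelCompactDist {α : Type u} (d : α → α → ℝ≥0∞) (A : Set α) : Prop :=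
  @IsCompact α (distTopology d) (@closure α (distTopology d) A)

/-! ### Compact metric spaces and isometric embeddings -/

/-- A compact metric space (possibly empty). -/
structure CompMet : Type (u + 1) where
  carrier : Type u
  [metric : MetricSpace carrier]
  [compact : CompactSpace carrier]

namespace CompMet

instance : CoeSort CompMet.{u} (Type u) := ⟨CompMet.carrier⟩

instance (X : CompMet.{u}) : MetricSpace X := X.metric

instance (X : CompMet.{u}) : CompactSpace X := X.compact

/-- The morphisms of compact metric spaces: isometric embeddings. -/
structure Hom (X Y : CompMet.{u}) where
  toFun : X → Y
  isometry : Isometry toFun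

namespace Hom

instance (X Y : CompMet.{u}) : CoeFun (Hom X Y) (fun _ => X → Y) := ⟨Hom.toFun⟩

@[ext]
theorem ext {X Y : CompMet.{u}} {f g : Hom X Y} (h : ∀ x, f x = g x) : f = g := by
  cases f; cases g; congr; exact funext h

/-- The identity morphism. -/
def id (X : CompMet.{u}) : Hom X X := ⟨fun x => x, isometry_id⟩

/-- Composition of isometric embeddings. -/
def comp {X Y Z : CompMet.{u}} (g : Hom Y Z) (f : Hom X Y) : Hom X Z :=
  ⟨fun x => g (f x), g.isometry.comp f.isometry⟩

/-- An isometry, seen as a morphism. -/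
def ofEquiv {X Y : CompMet.{u}} (e : X ≃ᵢ Y) : Hom X Y := ⟨e, e.isometry⟩

end Hom

/-- A compact subset `S` of a metric space, as a compact metric space. -/
def ofSet {X : Type u} [MetricSpace X] (S : Compacts X) : CompMet.{u} where
  carrier := {x : X // x ∈ S}
  compact := isCompact_iff_compactSpace.mp S.isCompact

/-- The inclusion map between two compact subsets. -/
def incl {X : Type u} [MetricSpace X] {S T : Compacts X} (h : S ≤ T) :
    Hom (ofSet S) (ofSet T) :=
  ⟨fun x => ⟨x.1, h x.2⟩, fun _ _ => rfl⟩

/-- The inclusion map of a compact subset of a compact metric space. -/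
def inclSpace {X : CompMet.{u}} (S : Compacts X) : Hom (ofSet S) X :=
  ⟨fun x => x.1, fun _ _ => rfl⟩

/-- The restriction `S → T` of an isometry `e : X → Y`, where `S` is the preimage of `T`. It is
itself an isometry. -/
def restrict {X Y : Type u} [MetricSpace X] [MetricSpace Y] (e : X ≃ᵢ Y)
    {S : Compacts X} {T : Compacts Y} (h : ∀ x, e x ∈ T ↔ x ∈ S) : ofSet S ≃ᵢ ofSet T where
  toEquiv := e.toEquiv.subtypeEquiv fun x => (h x).symm
  isometry_toFun := fun x y => e.isometry x.1 y.1

end CompMet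

/-! ### Functors to (extended) metric spaces, and the Gromov-Hausdorff-functor distance -/

/-- A functor from compact metric spaces to extended metric spaces; morphisms are isometric
embeddings on both sides. -/
structure MetFunctor where
  obj : CompMet.{u} → Type v
  [emetric : ∀ X, EMetricSpace (obj X)]
  map : ∀ {X Y : CompMet.{u}}, X.Hom Y → obj X → obj Y
  isometry_map : ∀ {X Y : CompMet.{u}} (f : X.Hom Y), Isometry (map f)
  map_id : ∀ (X : CompMet.{u}) (a : obj X), map (CompMet.Hom.id X) a = a
  map_comp : ∀ {X Y Z : CompMet.{u}} (g : Y.Hom Z) (f : X.Hom Y) (a : obj X),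
    map (g.comp f) a = map g (map f a)

namespace MetFunctor

instance (F : MetFunctor.{u, v}) (X : CompMet.{u}) : EMetricSpace (F.obj X) := F.emetric X

/-- If `f_n → f` pointwise, then `τ_{f_n} → τ_f` pointwise. -/
def PointwiseContinuous (F : MetFunctor.{u, v}) : Prop :=
  ∀ (X Y : CompMet.{u}) (f : X.Hom Y) (fs : ℕ → X.Hom Y),
    (∀ x, Tendsto (fun n => fs n x) atTop (𝓝 (f x))) →
    ∀ a : F.obj X, Tendsto (fun n => F.map (fs n) a) atTop (𝓝 (F.map f a))

/-- If `Im f_n → Im f` in the Hausdorff distance and `τ_{f_n}(a_n) → b`, then `b ∈ Im τ_f`. -/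
def HausdorffClosed (F : MetFunctor.{u, v}) : Prop :=
  ∀ (Z X : CompMet.{u}) (Xs : ℕ → CompMet.{u}) (f : X.Hom Z) (fs : ∀ n, (Xs n).Hom Z),
    Tendsto (fun n => Metric.hausdorffEDist (range (fs n)) (range f)) atTop (𝓝 0) →
    ∀ (b : F.obj Z) (a : ∀ n, F.obj (Xs n)),
      Tendsto (fun n => F.map (fs n) (a n)) atTop (𝓝 b) → b ∈ range (F.map f)

/-- A pair `(X, a)` with `X` a compact metric space and `a ∈ τ(X)`. -/
structure Pair (F : MetFunctor.{u, v}) where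
  space : CompMet.{u}
  pt : F.obj space

namespace Pair

variable {F : MetFunctor.{u, v}}

/-- Pairs are isomorphic if an isometry `e` satisfies `τ_e(a) = b`. -/
def Iso (P Q : F.Pair) : Prop :=
  ∃ e : P.space ≃ᵢ Q.space, F.map (CompMet.Hom.ofEquiv e) P.pt = Q.pt

theorem Iso.refl (P : F.Pair) : Iso P P := ⟨IsometryEquiv.refl _, F.map_id _ _⟩

theorem Iso.symm {P Q : F.Pair} : Iso P Q → Iso Q P := by
  rintro ⟨e, he⟩
  refine ⟨e.symm, ?_⟩
  rw [← he, ← F.map_comp]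
  convert F.map_id P.space P.pt using 2
  ext x
  exact e.symm_apply_apply x

theorem Iso.trans {P Q R : F.Pair} : Iso P Q → Iso Q R → Iso P R := by
  rintro ⟨e, he⟩ ⟨e', he'⟩
  refine ⟨e.trans e', ?_⟩
  rw [← he', ← he, ← F.map_comp]
  rfl

instance setoid (F : MetFunctor.{u, v}) : Setoid F.Pair :=
  ⟨Iso, Iso.refl, Iso.symm, Iso.trans⟩

/-- The Gromov-Hausdorff-functor distance of two pairs: the infimum over all compact metric
spaces `Z` and all isometric embeddings of both spaces into `Z`. -/
noncomputable def ghf (P Q : F.Pair) : ℝ≥0∞ :=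
  ⨅ (Z : CompMet.{u}) (f : P.space.Hom Z) (g : Q.space.Hom Z),
    max (Metric.hausdorffEDist (range f) (range g)) (edist (F.map f P.pt) (F.map g Q.pt))

theorem ghf_comm (P Q : F.Pair) : ghf P Q = ghf Q P := by
  unfold ghf
  refine iInf_congr fun Z => ?_
  rw [iInf_comm]
  simp only [Metric.hausdorffEDist_comm, edist_comm]

theorem ghf_le_of_iso {P P' Q : F.Pair} (h : Iso P P') : ghf P Q ≤ ghf P' Q := by
  obtain ⟨e, he⟩ := h
  refine le_iInf fun Z => le_iInf fun f => le_iInf fun g => ?_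
  refine iInf_le_of_le Z (iInf_le_of_le (f.comp (CompMet.Hom.ofEquiv e)) (iInf_le_of_le g ?_))
  rw [F.map_comp, he]
  have : range (f.comp (CompMet.Hom.ofEquiv e)) = range f := e.surjective.range_comp f
  rw [this]

theorem ghf_congr {P P' Q Q' : F.Pair} (h : Iso P P') (h' : Iso Q Q') :
    ghf P Q = ghf P' Q' := by
  have key : ∀ {P P' Q : F.Pair}, Iso P P' → ghf P Q = ghf P' Q := fun h =>
    le_antisymm (ghf_le_of_iso h) (ghf_le_of_iso h.symm)
  rw [key h, ghf_comm, key h', ghf_comm]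

end Pair

/-- The set `𝒞_τ` of isomorphism classes of pairs. -/
def Classes (F : MetFunctor.{u, v}) := Quotient (Pair.setoid F)

/-- The Gromov-Hausdorff-functor distance `d^c_τ` on `𝒞_τ`. -/
noncomputable def Classes.ghf {F : MetFunctor.{u, v}} : F.Classes → F.Classes → ℝ≥0∞ :=
  Quotient.lift₂ Pair.ghf fun _ _ _ _ h h' => Pair.ghf_congr h h'

/-- The functor `τ'(X) = X × τ(X)`, with the max product metric. -/
def pointed (F : MetFunctor.{u, v}) : MetFunctor.{u, max u v} where
  obj X := X × F.obj X
  map f p := (f p.1, F.map f p.2)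
  isometry_map f := f.isometry.prodMap (F.isometry_map f)
  map_id X a := Prod.ext rfl (F.map_id X a.2)
  map_comp g f a := Prod.ext rfl (F.map_comp g f a.2)

end MetFunctor

/-! ### Functors to ordered extended metric spaces, and truncation functors -/

/-- A functor from compact metric spaces to extended metric spaces with a partial order whose cones
`{a' | a' ≤ a}` are compact; the morphisms between the latter are the order-preserving isometric
embeddings. -/
structure PosMetFunctor extends MetFunctor.{u, v} where
  [order : ∀ X, PartialOrder (obj X)]
  isCompact_cone : ∀ (X : CompMet.{u}) (a : obj X), IsCompact {a' : obj X | a' ≤ a}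
  monotone_map : ∀ {X Y : CompMet.{u}} (f : X.Hom Y), Monotone (map f)

namespace PosMetFunctor

instance (τ : PosMetFunctor.{u, v}) (X : CompMet.{u}) : PartialOrder (τ.obj X) := τ.order X

/-- For every isometry `e : X → X` and `a ∈ τ(X)`, if `τ_e(a) ≤ a` then `τ_e(a) = a`. -/
def Rigid (τ : PosMetFunctor.{u, v}) : Prop :=
  ∀ (X : CompMet.{u}) (e : X ≃ᵢ X) (a : τ.obj X),
    τ.map (CompMet.Hom.ofEquiv e) a ≤ a → τ.map (CompMet.Hom.ofEquiv e) a = a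

/-- A truncation functor for `τ`: a contravariant functor to posets with the same objects as `τ`
such that `τᵗ_f (τ_f a) = a` and `τ_f (τᵗ_f b) ≤ b`. -/
structure Truncation (τ : PosMetFunctor.{u, v}) where
  tmap : ∀ {X Y : CompMet.{u}}, X.Hom Y → τ.obj Y → τ.obj X
  monotone_tmap : ∀ {X Y : CompMet.{u}} (f : X.Hom Y), Monotone (tmap f)
  tmap_id : ∀ (X : CompMet.{u}) (a : τ.obj X), tmap (CompMet.Hom.id X) a = a
  tmap_comp : ∀ {X Y Z : CompMet.{u}} (g : Y.Hom Z) (f : X.Hom Y) (c : τ.obj Z),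
    tmap (g.comp f) c = tmap f (tmap g c)
  tmap_map : ∀ {X Y : CompMet.{u}} (f : X.Hom Y) (a : τ.obj X), tmap f (τ.map f a) = a
  map_tmap_le : ∀ {X Y : CompMet.{u}} (f : X.Hom Y) (b : τ.obj Y), τ.map f (tmap f b) ≤ b

end PosMetFunctor

namespace PosMetFunctor.Truncation

variable {τ : PosMetFunctor.{u, v}}

/-- The extension `φ(X)` of `τ` to boundedly-compact spaces: families `a_Y ∈ τ(Y)`, indexed by the
compact subsets `Y` of `X`, which are compatible under truncation. -/
structure Ext (t : τ.Truncation) (X : Type u) [MetricSpace X] where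
  val : ∀ Y : Compacts X, τ.obj (CompMet.ofSet Y)
  compat : ∀ {Y Y' : Compacts X} (h : Y ≤ Y'), t.tmap (CompMet.incl h) (val Y') = val Y

/-- A tuple `(X, o; a)` with `X` a boundedly-compact metric space, `o ∈ X` and `a ∈ φ(X)`. -/
structure Tuple (t : τ.Truncation) where
  space : Type u
  [metric : MetricSpace space]
  [proper : ProperSpace space]
  o : space
  a : t.Ext space

namespace Tuple

variable {t : τ.Truncation}

instance (X : t.Tuple) : MetricSpace X.space := X.metric

instance (X : t.Tuple) : ProperSpace X.space := X.proper

/-- Tuples are isomorphic if there is an isometry `e` preserving the distinguished points such that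
`φ_e(a) = a'`, that is, `a'_{Y'} = τ_g(a_Y)` for all compact sets `Y'`, where `Y = e⁻¹(Y')` and
`g : Y → Y'` is the restriction of `e`. -/
def Iso (X X' : t.Tuple) : Prop :=
  ∃ e : X.space ≃ᵢ X'.space, e X.o = X'.o ∧
    ∀ (Y : Compacts X.space) (Y' : Compacts X'.space) (h : ∀ x, e x ∈ Y' ↔ x ∈ Y),
      τ.map (CompMet.Hom.ofEquiv (CompMet.restrict e h)) (X.a.val Y) = X'.a.val Y'

/-- The image of a compact set under an isometry. -/
def imageSet {X Y : Type u} [MetricSpace X] [MetricSpace Y] (e : X ≃ᵢ Y) (S : Compacts X) :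
    Compacts Y :=
  S.map e e.continuous

theorem mem_imageSet {X Y : Type u} [MetricSpace X] [MetricSpace Y] (e : X ≃ᵢ Y)
    (S : Compacts X) (x : X) : e x ∈ imageSet e S ↔ x ∈ S := by
  change e x ∈ e '' (S : Set X) ↔ _
  simp

theorem Iso.refl (X : t.Tuple) : Iso X X := by
  refine ⟨IsometryEquiv.refl _, rfl, fun Y Y' h => ?_⟩
  obtain rfl : Y = Y' := by
    ext x
    exact (h x).symm
  exact τ.map_id _ _

theorem Iso.symm {X X' : t.Tuple} : Iso X X' → Iso X' X := by
  rintro ⟨e, ho, he⟩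
  refine ⟨e.symm, by rw [← ho, e.symm_apply_apply], fun Y' Y h => ?_⟩
  have h' : ∀ x, e x ∈ Y' ↔ x ∈ Y := fun x => by rw [← h, e.symm_apply_apply]
  rw [← he Y Y' h', ← τ.map_comp]
  convert τ.map_id _ (X.a.val Y) using 2
  ext x
  exact Subtype.ext (e.symm_apply_apply x.1)

theorem Iso.trans {X Y Z : t.Tuple} : Iso X Y → Iso Y Z → Iso X Z := by
  rintro ⟨e, ho, he⟩ ⟨e', ho', he'⟩
  refine ⟨e.trans e', by rw [← ho', ← ho]; rfl, fun S T h => ?_⟩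
  have h1 := mem_imageSet e S
  have h2 : ∀ y, e' y ∈ T ↔ y ∈ imageSet e S := fun y => by
    obtain ⟨x, rfl⟩ := e.surjective y
    rw [h1, ← h]
    rfl
  rw [← he' _ _ h2, ← he _ _ h1, ← τ.map_comp]
  rfl

instance setoid (t : τ.Truncation) : Setoid t.Tuple := ⟨Iso, Iso.refl, Iso.symm, Iso.trans⟩

/-- The tuples `𝒳' ⪯ 𝒳` with compact underlying space: a compact subset of `X` containing `o`,
together with an element `a'` of `τ` of this subset which is at most the truncation of `a`. -/
structure Sub (X : t.Tuple) where
  carrier : Compacts X.space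
  o_mem : X.o ∈ carrier
  a : τ.obj (CompMet.ofSet carrier)
  a_le : a ≤ X.a.val carrier

/-- The relation `⪯` between tuples `⪯ 𝒳`. -/
instance (X : t.Tuple) : LE X.Sub where
  le P Q := ∃ h : P.carrier ≤ Q.carrier, P.a ≤ t.tmap (CompMet.incl h) Q.a

/-- A compact tuple `𝒳' ⪯ 𝒳`, as a pair for the functor `τ'`. -/
def Sub.toPair {X : t.Tuple} (P : X.Sub) : τ.pointed.Pair where
  space := CompMet.ofSet P.carrier
  pt := (⟨X.o, P.o_mem⟩, P.a)

/-- The truncated ball `𝒳^(r)`: the closed ball of radius `r` centered at `o` with the truncation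
of `a` to it. -/
def ball (X : t.Tuple) (r : ℝ≥0) : X.Sub where
  carrier := ⟨Metric.closedBall X.o r, isCompact_closedBall X.o r⟩
  o_mem := Metric.mem_closedBall_self r.2
  a := X.a.val _
  a_le := le_rfl

/-- The quantity `a_ε(𝒳, 𝒴)`: the infimum of `d^c(𝒳^(1/ε), 𝒴')` over all compact `𝒴'` such that
`𝒴^(1/ε-ε) ⪯ 𝒴' ⪯ 𝒴`. It is used for `0 < ε ≤ 1` only, where `1/ε-ε ≥ 0`. -/
noncomputable def approx (ε : ℝ≥0) (X Y : t.Tuple) : ℝ≥0∞ :=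
  ⨅ (Y' : Y.Sub) (_ : Y.ball (1 / ε - ε) ≤ Y'), (X.ball (1 / ε)).toPair.ghf Y'.toPair

/-- The distance of two tuples: the infimum of the `ε ∈ (0, 1]` such that
`a_ε(𝒳, 𝒴) ∨ a_ε(𝒴, 𝒳) < ε / 2`. Inserting `1` realizes the convention `inf ∅ = 1` and changes
nothing otherwise. -/
noncomputable def distance (X Y : t.Tuple) : ℝ≥0 :=
  sInf (insert 1 {ε : ℝ≥0 | 0 < ε ∧ ε ≤ 1 ∧
    max (approx ε X Y) (approx ε Y X) < (ε : ℝ≥0∞) / 2})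

theorem ball_iso {X X' : t.Tuple} (h : Iso X X') (r : ℝ≥0) :
    (X.ball r).toPair.Iso (X'.ball r).toPair := by
  obtain ⟨e, ho, he⟩ := h
  have hb : ∀ x, e x ∈ (X'.ball r).carrier ↔ x ∈ (X.ball r).carrier := fun x => by
    change e x ∈ Metric.closedBall X'.o r ↔ x ∈ Metric.closedBall X.o r
    rw [← ho, Metric.mem_closedBall, Metric.mem_closedBall, e.dist_eq]
  exact ⟨CompMet.restrict e hb, Prod.ext (Subtype.ext ho) (he _ _ hb)⟩

theorem exists_sub_iso {X X' : t.Tuple} (h : Iso X X') (r : ℝ≥0) (P : X.Sub)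
    (hP : X.ball r ≤ P) : ∃ P' : X'.Sub, X'.ball r ≤ P' ∧ P.toPair.Iso P'.toPair := by
  obtain ⟨e, ho, he⟩ := h
  have hm := mem_imageSet e P.carrier
  have hb : ∀ x, e x ∈ (X'.ball r).carrier ↔ x ∈ (X.ball r).carrier := fun x => by
    change e x ∈ Metric.closedBall X'.o r ↔ x ∈ Metric.closedBall X.o r
    rw [← ho, Metric.mem_closedBall, Metric.mem_closedBall, e.dist_eq]
  refine ⟨⟨imageSet e P.carrier, by rw [← ho, hm]; exact P.o_mem,
    τ.map (CompMet.Hom.ofEquiv (CompMet.restrict e hm)) P.a, ?_⟩, ?_, ?_⟩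
  · rw [← he _ _ hm]
    exact τ.monotone_map _ P.a_le
  · obtain ⟨hsub, hle⟩ := hP
    have hsub' : (X'.ball r).carrier ≤ imageSet e P.carrier := fun y hy => by
      obtain ⟨x, rfl⟩ := e.surjective y
      exact (hm x).2 (hsub ((hb x).1 hy))
    refine ⟨hsub', ?_⟩
    have hball : (X'.ball r).a =
        τ.map (CompMet.Hom.ofEquiv (CompMet.restrict e hb)) (X.ball r).a := (he _ _ hb).symm
    rw [hball, ← t.tmap_map (CompMet.incl hsub')
      (τ.map (CompMet.Hom.ofEquiv (CompMet.restrict e hb)) (X.ball r).a)]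
    refine t.monotone_tmap _ ?_
    have key : τ.map (CompMet.incl hsub')
          (τ.map (CompMet.Hom.ofEquiv (CompMet.restrict e hb)) (X.ball r).a) =
        τ.map (CompMet.Hom.ofEquiv (CompMet.restrict e hm))
          (τ.map (CompMet.incl hsub) (X.ball r).a) := by
      rw [← τ.map_comp, ← τ.map_comp]
      rfl
    refine key.trans_le (τ.monotone_map _ ?_)
    exact (τ.monotone_map _ hle).trans (t.map_tmap_le _ _)
  · exact ⟨CompMet.restrict e hm, Prod.ext (Subtype.ext ho) rfl⟩

theorem approx_congr {X X' Y Y' : t.Tuple} (hX : Iso X X') (hY : Iso Y Y') (ε : ℝ≥0) :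
    approx ε X Y = approx ε X' Y' := by
  have key : ∀ {X X' Y Y' : t.Tuple}, Iso X X' → Iso Y Y' → approx ε X Y ≤ approx ε X' Y' := by
    intro X X' Y Y' hX hY
    refine le_iInf fun Q' => le_iInf fun hQ' => ?_
    obtain ⟨Q, hQ, hi⟩ := exists_sub_iso hY.symm _ Q' hQ'
    refine iInf_le_of_le Q (iInf_le_of_le hQ ?_)
    exact (MetFunctor.Pair.ghf_congr (ball_iso hX _) hi.symm).le
  exact le_antisymm (key hX hY) (key hX.symm hY.symm)

/-- The tuple `(X, o; a)` of a compact space `X` and `a ∈ τ(X)`; the corresponding element of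
`φ(X)` consists of all the truncations of `a`. -/
def ofPair (t : τ.Truncation) (P : τ.pointed.Pair) : t.Tuple where
  space := P.space
  o := P.pt.1
  a :=
    { val := fun Y => t.tmap (CompMet.inclSpace Y) P.pt.2
      compat := fun _ => (t.tmap_comp _ _ _).symm }

end Tuple

/-- The set `𝒞'` of isomorphism classes of tuples `(X, o; a)`. -/
def Classes (t : τ.Truncation) := Quotient (Tuple.setoid t)

/-- The class of a tuple. -/
def Tuple.toClass {t : τ.Truncation} (X : t.Tuple) : t.Classes := Quotient.mk _ X

/-- The class in `𝒞 = 𝒞_τ'` of a compact tuple `𝒳' ⪯ 𝒳`. -/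
def Tuple.Sub.toClass {t : τ.Truncation} {X : t.Tuple} (P : X.Sub) : τ.pointed.Classes :=
  Quotient.mk _ P.toPair

/-- The metric of `𝒞'`. -/
noncomputable def Classes.distance {t : τ.Truncation} : t.Classes → t.Classes → ℝ≥0 :=
  Quotient.lift₂ Tuple.distance fun _ _ _ _ hX hY => by
    unfold Tuple.distance
    simp only [Tuple.approx_congr hX hY, Tuple.approx_congr hY hX]

/-- For a set `𝒜 ⊆ 𝒞'`, the set `𝒜_r` of the classes of the truncated balls `𝒳^(r)`, `𝒳 ∈ 𝒜`. -/
def ballClasses {t : τ.Truncation} (A : Set t.Classes) (r : ℝ≥0) : Set τ.pointed.Classes :=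
  {c | ∃ X : t.Tuple, X.toClass ∈ A ∧ (X.ball r).toClass = c}

/-- For all compact tuples `𝒳`, `𝒴` and every `𝒳' ⪯ 𝒳` there exists `𝒴' ⪯ 𝒴` such that
`d^c(𝒳', 𝒴') ≤ d^c(𝒳, 𝒴)`. -/
def SubtupleApprox (t : τ.Truncation) : Prop :=
  ∀ (P Q : τ.pointed.Pair) (P' : (Tuple.ofPair t P).Sub),
    ∃ Q' : (Tuple.ofPair t Q).Sub, P'.toPair.ghf Q'.toPair ≤ P.ghf Q

/-- In the previous property, if `𝒳^(r) ⪯ 𝒳' ⪯ 𝒳` and `r ≥ 2 ε`, where `ε = d^c(𝒳, 𝒴)`, then `𝒴'`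
can be chosen such that also `𝒴^(r - 2 ε) ⪯ 𝒴' ⪯ 𝒴`. -/
def SubtupleApproxBall (t : τ.Truncation) : Prop :=
  ∀ (P Q : τ.pointed.Pair) (P' : (Tuple.ofPair t P).Sub) (ε r : ℝ≥0),
    P.ghf Q = ε → 2 * ε ≤ r → (Tuple.ofPair t P).ball r ≤ P' →
    ∃ Q' : (Tuple.ofPair t Q).Sub,
      (Tuple.ofPair t Q).ball (r - 2 * ε) ≤ Q' ∧ P'.toPair.ghf Q'.toPair ≤ P.ghf Q

end PosMetFunctor.Truncation

/-!
Relative compactness is tested on ultrafilters of tuples. If an ultrafilter converges to a tuple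
`X`, then its balls of radius `r` come arbitrarily close to compact subtuples of the ball of radius
`r + 1` of `X`; these form a compact set, so the balls converge. Conversely, suppose that the balls
of radius `k + 1` converge to `L k` for all `k`. Although truncation to a fixed radius is not
continuous, rigidity shows that `L k` lies between the ball of radius `k` of `L (k + 1)` and
`L (k + 1)`. So the balls of radius `k` of the `L k` form a chain in which each is the ball of the
next one, and the ultrafilter converges to their direct limit.
-/

/-! ### Relative compactness in terms of ultrafilters -/

theorem isRelCompactDist_edist {α : Type u} [PseudoEMetricSpace α] {A : Set α} :
    IsRelCompactDist (edist : α → α → ℝ≥0∞) A ↔ IsCompact (closure A) := by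
  have h : distTopology (edist : α → α → ℝ≥0∞) = UniformSpace.toTopologicalSpace := by
    refine TopologicalSpace.ext_iff.2 fun s => ?_
    rw [EMetric.isOpen_iff]
    simp only [subset_def, Metric.mem_eball, edist_comm _ (_ : α)]
    rfl
  rw [IsRelCompactDist, h]

theorem isCompact_closure_iff_ultrafilter {α : Type*} [TopologicalSpace α] [RegularSpace α]
    {A : Set α} :
    IsCompact (closure A) ↔ ∀ U : Ultrafilter α, A ∈ U → ∃ x, (U : Filter α) ≤ 𝓝 x := by
  rw [isCompact_iff_ultrafilter_le_nhds']
  refine ⟨fun h U hU => ?_, fun h U hU => ?_⟩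
  · obtain ⟨x, -, hx⟩ := h U (mem_of_superset hU subset_closure)
    exact ⟨x, hx⟩
  · -- The open sets of `U` meet `A`, so some ultrafilter on `A` contains all of them; its
    -- limits are limits of `U`, as the space is regular.
    have hne : (Filter.bind (U : Filter α) 𝓝 ⊓ 𝓟 A).NeBot := by
      rw [← frequently_mem_iff_neBot]
      intro hA
      obtain ⟨x, hx, hxA⟩ := U.nonempty_of_mem (inter_mem hU hA)
      exact mem_closure_iff_frequently.1 hx hxA
    obtain ⟨V, hV⟩ := Ultrafilter.exists_le (Filter.bind (U : Filter α) 𝓝 ⊓ 𝓟 A)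
    obtain ⟨x, hx⟩ := h V (le_principal_iff.1 (hV.trans inf_le_right))
    have hUx : (U : Filter α) ≤ 𝓝 x := by
      refine (closed_nhds_basis x).ge_iff.2 fun C ⟨hC, hC'⟩ => ?_
      by_contra hCU
      have hVC : Cᶜ ∈ V := hV.trans inf_le_left <| by
        refine mem_bind.2 ⟨Cᶜ, Ultrafilter.compl_mem_iff_notMem.2 hCU, fun y hy => ?_⟩
        exact hC'.isOpen_compl.mem_nhds hy
      exact Ultrafilter.compl_mem_iff_notMem.1 hVC (hx hC)
    exact ⟨x, isClosed_closure.mem_of_tendsto hUx hU, hUx⟩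

theorem isCompact_closure_image_iff_ultrafilter {α β : Type*} [TopologicalSpace α]
    [RegularSpace α] {f : β → α} {S : Set β} :
    IsCompact (closure (f '' S)) ↔ ∀ V : Ultrafilter β, S ∈ V → ∃ x, Tendsto f V (𝓝 x) := by
  rw [isCompact_closure_iff_ultrafilter]
  refine ⟨fun h V hV => h (V.map f) (image_mem_map hV), fun h U hU => ?_⟩
  obtain ⟨x, hx⟩ := h _ (Ultrafilter.ofComapInfPrincipal_mem hU)
  refine ⟨x, ?_⟩
  rwa [← Ultrafilter.ofComapInfPrincipal_eq_of_map hU]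

theorem exists_le_nhds_of_forall_thickening_mem {α : Type*} [PseudoEMetricSpace α] {K : Set α}
    (hK : IsCompact K) {U : Ultrafilter α} (hU : ∀ δ : ℝ, 0 < δ → Metric.thickening δ K ∈ U) :
    ∃ x, (U : Filter α) ≤ 𝓝 x := by
  by_contra! h
  have hdisj : Disjoint (𝓝ˢ K) U :=
    hK.disjoint_nhdsSet_left.2 fun x _ => (Ultrafilter.disjoint_iff_not_le.2 (h x)).symm
  have hle : (U : Filter α) ≤ 𝓝ˢ K := (Metric.hasBasis_nhdsSet_thickening hK).ge_iff.2 hU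
  exact U.neBot.ne (disjoint_self.1 (hdisj.mono_left hle))

theorem surjective_of_isometry_of_compactSpace {X : Type*} [MetricSpace X] [CompactSpace X]
    {f : X → X} (hf : Isometry f) : Function.Surjective f := by
  intro x
  by_contra hx
  have hiter (n : ℕ) : Isometry f^[n] := by
    induction n with
    | zero => exact isometry_id
    | succ n ih => exact ih.comp hf
  have hopen : IsOpen (range f)ᶜ := (isCompact_range hf.continuous).isClosed.isOpen_compl
  obtain ⟨ε, hε, hball⟩ := Metric.isOpen_iff.1 hopen x hx
  obtain ⟨a, φ, hφ, hlim⟩ := CompactSpace.tendsto_subseq fun n => f^[n] x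
  obtain ⟨N, hN⟩ := Metric.cauchySeq_iff'.1 hlim.cauchySeq ε hε
  obtain ⟨k, hk⟩ := Nat.exists_eq_add_of_lt (hφ N.lt_succ_self)
  have hdist : dist (f^[φ (N + 1)] x) (f^[φ N] x) = dist (f (f^[k] x)) x := by
    rw [hk, add_assoc, Function.iterate_add_apply, (hiter _).dist_eq,
      Function.iterate_succ_apply']
  have hlt : dist (f (f^[k] x)) x < ε := hdist.symm.trans_lt (hN (N + 1) N.le_succ)
  exact hball hlt (mem_range_self _)

/-! ### Spaces of isometric embeddings -/

/-- The `K`-Lipschitz functions with values in `s`, which for compact `α` and `s` form a compact set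
by Arzelà-Ascoli. -/
def lipschitzFunctions (α : Type*) {β : Type*} [PseudoMetricSpace α] [PseudoMetricSpace β]
    (K : ℝ≥0) (s : Set β) : Set (BoundedContinuousFunction α β) :=
  {h | LipschitzWith K h ∧ ∀ x, h x ∈ s}

theorem isCompact_lipschitzFunctions {α β : Type*} [PseudoMetricSpace α] [CompactSpace α]
    [MetricSpace β] (K : ℝ≥0) {s : Set β} (hs : IsCompact s) :
    IsCompact (lipschitzFunctions α K s) := by
  refine BoundedContinuousFunction.arzela_ascoli₂ s hs _ ?_ (fun h x hh => hh.2 x) ?_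
  · have heval (x : α) : Continuous fun h : BoundedContinuousFunction α β => h x :=
      continuous_eval_const x
    simp only [lipschitzFunctions, LipschitzWith, ofPred_and, ofPred_forall]
    refine IsClosed.inter ?_ ?_
    · exact isClosed_iInter fun x => isClosed_iInter fun y =>
        isClosed_le ((heval x).edist (heval y)) continuous_const
    · exact isClosed_iInter fun x => hs.isClosed.preimage (heval x)
  · exact (LipschitzWith.uniformEquicontinuous _ K fun h => h.2.1).equicontinuous

instance compactSpace_glueSpace {X Y Z : Type*} [Nonempty Z] [MetricSpace Z] [MetricSpace X]
    [MetricSpace Y] [CompactSpace X] [CompactSpace Y] {Φ : Z → X} {Ψ : Z → Y} (hΦ : Isometry Φ)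
    (hΨ : Isometry Ψ) : CompactSpace (Metric.GlueSpace hΦ hΨ) := by
  have hcover : range (Metric.toGlueL hΦ hΨ) ∪ range (Metric.toGlueR hΦ hΨ) = univ := by
    refine eq_univ_of_forall fun z => ?_
    obtain ⟨x | y, rfl⟩ := Quotient.exists_rep z
    · exact Or.inl ⟨x, rfl⟩
    · exact Or.inr ⟨y, rfl⟩
  refine ⟨hcover ▸ IsCompact.union ?_ ?_⟩
  · exact isCompact_range (Metric.toGlueL_isometry hΦ hΨ).continuous
  · exact isCompact_range (Metric.toGlueR_isometry hΦ hΨ).continuous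

namespace CompMet

variable {X Y Z W C D : CompMet.{u}}

theorem exists_amalgam [Nonempty Z] (f : Z.Hom X) (g : Z.Hom Y) :
    ∃ (W : CompMet.{u}) (f' : X.Hom W) (g' : Y.Hom W), f'.comp f = g'.comp g :=
  ⟨⟨Metric.GlueSpace f.isometry g.isometry⟩,
    ⟨_, Metric.toGlueL_isometry f.isometry g.isometry⟩,
    ⟨_, Metric.toGlueR_isometry f.isometry g.isometry⟩,
    Hom.ext fun z => congrFun (Metric.toGlue_commute f.isometry g.isometry) z⟩

namespace Hom

theorem range_comp (g : Y.Hom Z) (f : X.Hom Y) : range (g.comp f) = g '' range f :=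
  Set.range_comp g f

/-- The bounded continuous function underlying an isometric embedding of a compact space; it induces
the metric of uniform convergence on `X.Hom Y`. -/
def toBoundedContinuousFunction (f : X.Hom Y) : BoundedContinuousFunction X Y :=
  BoundedContinuousFunction.mkOfCompact ⟨f, f.isometry.continuous⟩

theorem toBoundedContinuousFunction_injective :
    Function.Injective (toBoundedContinuousFunction : X.Hom Y → BoundedContinuousFunction X Y) :=
  fun _ _ h => Hom.ext fun x => DFunLike.congr_fun h x

noncomputable instance : MetricSpace (X.Hom Y) :=
  MetricSpace.induced _ toBoundedContinuousFunction_injective inferInstance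

theorem continuous_eval (x : X) : Continuous fun f : X.Hom Y => f x :=
  (continuous_eval_const x).comp
    (continuous_induced_dom (f := (toBoundedContinuousFunction : X.Hom Y → _)))

instance : CompactSpace (X.Hom Y) := by
  have hind : IsInducing (toBoundedContinuousFunction : X.Hom Y → BoundedContinuousFunction X Y) :=
    ⟨rfl⟩
  have hrange : range (toBoundedContinuousFunction : X.Hom Y → BoundedContinuousFunction X Y) =
      {h : BoundedContinuousFunction X Y | Isometry h} := by
    ext h
    exact ⟨fun ⟨f, hf⟩ => hf ▸ f.isometry, fun hh => ⟨⟨h, hh⟩, rfl⟩⟩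
  have hclosed : IsClosed {h : BoundedContinuousFunction X Y | Isometry h} := by
    simp only [Isometry, ofPred_forall]
    exact isClosed_iInter fun x => isClosed_iInter fun y =>
      isClosed_eq ((continuous_eval_const x).edist (continuous_eval_const y)) continuous_const
  rw [← isCompact_univ_iff, hind.isCompact_iff, image_univ, hrange]
  refine (isCompact_lipschitzFunctions 1 (isCompact_univ (X := Y))).of_isClosed_subset hclosed ?_
  exact fun h hh => ⟨hh.lipschitz, fun x => mem_univ _⟩

/-- The factorization of an isometric embedding `h` through an isometric embedding `g`. -/
noncomputable def lift {E : Type*} [MetricSpace E] {g : D → E} {h : C → E} (hg : Isometry g)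
    (hh : Isometry h) (hr : range h ⊆ range g) : C.Hom D where
  toFun c := (hr (mem_range_self c)).choose
  isometry := Isometry.of_dist_eq fun c c' => by
    rw [← hg.dist_eq, (hr (mem_range_self c)).choose_spec, (hr (mem_range_self c')).choose_spec,
      hh.dist_eq]

theorem apply_lift {E : Type*} [MetricSpace E] {g : D → E} {h : C → E} (hg : Isometry g)
    (hh : Isometry h) (hr : range h ⊆ range g) (c : C) : g (lift hg hh hr c) = h c :=
  (hr (mem_range_self c)).choose_spec

/-- A surjective isometric embedding, as an isometry. -/
noncomputable def equivOfSurjective (f : X.Hom Y) (hf : Function.Surjective f) : X ≃ᵢ Y where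
  toEquiv := Equiv.ofBijective f ⟨f.isometry.injective, hf⟩
  isometry_toFun := f.isometry

theorem ofEquiv_equivOfSurjective (f : X.Hom Y) (hf : Function.Surjective f) :
    ofEquiv (f.equivOfSurjective hf) = f :=
  rfl

theorem isClosed_range (f : X.Hom Y) : IsClosed (range f) :=
  (isCompact_range f.isometry.continuous).isClosed

/-- The image of an isometric embedding, as a compact subset. -/
def rangeCompacts (f : X.Hom Y) : Compacts Y := ⟨range f, isCompact_range f.isometry.continuous⟩

theorem lipschitzWith_rangeCompacts :
    LipschitzWith 1 (rangeCompacts : X.Hom Y → Compacts Y) := by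
  intro f g
  have hfg (x : X) : edist (f x) (g x) ≤ edist f g := by
    rw [edist_dist, edist_dist]
    exact ENNReal.ofReal_le_ofReal (BoundedContinuousFunction.dist_coe_le_dist
      (f := f.toBoundedContinuousFunction) (g := g.toBoundedContinuousFunction) x)
  rw [ENNReal.coe_one, one_mul, Compacts.edist_eq]
  refine Metric.hausdorffEDist_le_of_mem_edist ?_ ?_
  · rintro _ ⟨x, rfl⟩
    exact ⟨g x, mem_range_self x, hfg x⟩
  · rintro _ ⟨x, rfl⟩
    exact ⟨f x, mem_range_self x, edist_comm (f x) (g x) ▸ hfg x⟩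

theorem continuous_hausdorffEDist_range :
    Continuous fun p : X.Hom Z × Y.Hom Z => Metric.hausdorffEDist (range p.1) (range p.2) :=
  (lipschitzWith_rangeCompacts.continuous.comp continuous_fst).edist
    (lipschitzWith_rangeCompacts.continuous.comp continuous_snd)

end Hom

/-! ### Embedding a union of two compact spaces into a space of Lipschitz functions -/

/-- The compact space of pairs of `1`-Lipschitz functions on `X` and `Y` with values in `[0, R]`.
Every space covered by isometric copies of `X` and `Y` and of diameter at most `R` embeds into it,
by sending a point to its distance functions to the two copies. -/
noncomputable def lipschitzSpace (X Y : CompMet.{u}) (R : ℝ) : CompMet.{u} where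
  carrier := {w : BoundedContinuousFunction X ℝ × BoundedContinuousFunction Y ℝ //
    w ∈ lipschitzFunctions X 1 (Icc 0 R) ×ˢ lipschitzFunctions Y 1 (Icc 0 R)}
  compact := isCompact_iff_compactSpace.1 <|
    (isCompact_lipschitzFunctions 1 isCompact_Icc).prod
      (isCompact_lipschitzFunctions 1 isCompact_Icc)

/-- The function `x ↦ d(z, f x)`. -/
noncomputable def distFunction (f : X.Hom Z) (z : Z) : BoundedContinuousFunction X ℝ :=
  BoundedContinuousFunction.mkOfCompact
    ⟨fun x => dist z (f x), continuous_const.dist f.isometry.continuous⟩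

theorem lipschitzWith_distFunction (f : X.Hom Z) (z : Z) : LipschitzWith 1 (distFunction f z) := by
  refine LipschitzWith.of_dist_le_mul fun x y => ?_
  rw [NNReal.coe_one, one_mul, ← f.isometry.dist_eq]
  exact dist_dist_dist_le_right _ _ _

theorem dist_distFunction_le (f : X.Hom Z) (z z' : Z) :
    dist (distFunction f z) (distFunction f z') ≤ dist z z' :=
  (BoundedContinuousFunction.dist_le dist_nonneg).2 fun _ => dist_dist_dist_le_left _ _ _

theorem dist_distFunction_of_mem_range (f : X.Hom Z) {z : Z} (hz : z ∈ range f) (z' : Z) :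
    dist (distFunction f z) (distFunction f z') = dist z z' := by
  refine le_antisymm (dist_distFunction_le f z z') ?_
  obtain ⟨x, rfl⟩ := hz
  calc dist (f x) z' = dist (distFunction f (f x) x) (distFunction f z' x) := by
        change _ = |dist (f x) (f x) - dist z' (f x)|
        rw [dist_self, zero_sub, abs_neg, abs_of_nonneg dist_nonneg, dist_comm]
    _ ≤ _ := BoundedContinuousFunction.dist_coe_le_dist x

theorem exists_hom_lipschitzSpace {R : ℝ} (f : X.Hom Z) (g : Y.Hom Z)
    (hR : ∀ z ∈ range f ∪ range g, ∀ z' ∈ range f ∪ range g, dist z z' ≤ R) :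
    ∃ (D : CompMet.{u}) (f' : X.Hom D) (g' : Y.Hom D) (i : D.Hom Z)
      (_ : D.Hom (lipschitzSpace X Y R)), i.comp f' = f ∧ i.comp g' = g := by
  let D : Compacts Z := f.rangeCompacts ⊔ g.rangeCompacts
  have hmem (z : ofSet D) : (distFunction f z.1, distFunction g z.1) ∈
      lipschitzFunctions X 1 (Icc 0 R) ×ˢ lipschitzFunctions Y 1 (Icc 0 R) :=
    ⟨⟨lipschitzWith_distFunction f _, fun x =>
        ⟨dist_nonneg, hR _ z.2 _ (Or.inl (mem_range_self x))⟩⟩,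
      lipschitzWith_distFunction g _, fun y =>
        ⟨dist_nonneg, hR _ z.2 _ (Or.inr (mem_range_self y))⟩⟩
  refine ⟨ofSet D, ⟨fun x => ⟨f x, Or.inl (mem_range_self x)⟩, f.isometry⟩,
    ⟨fun y => ⟨g y, Or.inr (mem_range_self y)⟩, g.isometry⟩, inclSpace D,
    ⟨fun z => ⟨_, hmem z⟩, Isometry.of_dist_eq fun z z' => ?_⟩, rfl, rfl⟩
  change max (dist (distFunction f z.1) (distFunction f z'.1))
    (dist (distFunction g z.1) (distFunction g z'.1)) = dist z.1 z'.1
  rcases z.2 with hz | hz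
  · rw [dist_distFunction_of_mem_range f hz]
    exact max_eq_left (dist_distFunction_le _ _ _)
  · rw [dist_distFunction_of_mem_range g hz]
    exact max_eq_right (dist_distFunction_le _ _ _)

end CompMet

/-! ### The Gromov-Hausdorff-functor distance -/

namespace MetFunctor

variable {F : MetFunctor.{u, v}}

namespace PointwiseContinuous

theorem continuous_map (hF : F.PointwiseContinuous) {X Y : CompMet.{u}} (a : F.obj X) :
    Continuous fun f : X.Hom Y => F.map f a := by
  refine continuous_iff_seqContinuous.2 fun fs f hfs => ?_
  exact hF X Y f fs (fun x => (CompMet.Hom.continuous_eval x).continuousAt.tendsto.comp hfs) a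

theorem pointed (hF : F.PointwiseContinuous) : F.pointed.PointwiseContinuous :=
  fun X Y f fs hfs a => (hfs a.1).prodMk_nhds (hF X Y f fs hfs a.2)

end PointwiseContinuous

namespace Pair

/-- The quantity whose infimum over all pairs of isometric embeddings `f`, `g` into a common space
is the Gromov-Hausdorff-functor distance of `P` and `Q`. -/
noncomputable def mismatch (P Q : F.Pair) {Z : CompMet.{u}} (f : P.space.Hom Z)
    (g : Q.space.Hom Z) : ℝ≥0∞ :=
  max (Metric.hausdorffEDist (range f) (range g)) (edist (F.map f P.pt) (F.map g Q.pt))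

variable {P Q R : F.Pair} {Z W : CompMet.{u}}

theorem ghf_eq_iInf_mismatch (P Q : F.Pair) :
    P.ghf Q = ⨅ (Z : CompMet.{u}) (f : P.space.Hom Z) (g : Q.space.Hom Z), P.mismatch Q f g :=
  rfl

theorem ghf_le_mismatch (f : P.space.Hom Z) (g : Q.space.Hom Z) : P.ghf Q ≤ P.mismatch Q f g :=
  iInf_le_of_le Z (iInf_le_of_le f (iInf_le _ g))

theorem ghf_lt_iff {ε : ℝ≥0∞} :
    P.ghf Q < ε ↔ ∃ (Z : CompMet.{u}) (f : P.space.Hom Z) (g : Q.space.Hom Z),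
      P.mismatch Q f g < ε := by
  simp only [ghf_eq_iInf_mismatch, iInf_lt_iff]

theorem mismatch_comp (k : Z.Hom W) (f : P.space.Hom Z) (g : Q.space.Hom Z) :
    P.mismatch Q (k.comp f) (k.comp g) = P.mismatch Q f g := by
  simp only [mismatch, CompMet.Hom.range_comp, Metric.hausdorffEDist_image k.isometry, F.map_comp,
    (F.isometry_map k).edist_eq]

theorem mismatch_triangle (f : P.space.Hom Z) (g : Q.space.Hom Z) (h : R.space.Hom Z) :
    P.mismatch R f h ≤ P.mismatch Q f g + Q.mismatch R g h :=
  max_le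
    (Metric.hausdorffEDist_triangle.trans (add_le_add (le_max_left _ _) (le_max_left _ _)))
    ((edist_triangle _ _ _).trans (add_le_add (le_max_right _ _) (le_max_right _ _)))

theorem ghf_self (P : F.Pair) : P.ghf P = 0 :=
  bot_unique <| (ghf_le_mismatch (CompMet.Hom.id _) (CompMet.Hom.id _)).trans_eq <| by
    simp [mismatch]

theorem ghf_triangle (P Q R : F.Pair) [Nonempty Q.space] : P.ghf R ≤ P.ghf Q + Q.ghf R := by
  have hamalgam {Z Z' : CompMet.{u}} (f : P.space.Hom Z) (g : Q.space.Hom Z)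
      (g' : Q.space.Hom Z') (h : R.space.Hom Z') :
      P.ghf R ≤ P.mismatch Q f g + Q.mismatch R g' h := by
    obtain ⟨W, k, k', hk⟩ := CompMet.exists_amalgam g g'
    calc P.ghf R ≤ P.mismatch R (k.comp f) (k'.comp h) := ghf_le_mismatch _ _
      _ ≤ P.mismatch Q (k.comp f) (k.comp g) + Q.mismatch R (k.comp g) (k'.comp h) :=
        mismatch_triangle _ _ _
      _ = P.mismatch Q f g + Q.mismatch R g' h := by rw [mismatch_comp, hk, mismatch_comp]
  rw [ghf_eq_iInf_mismatch P Q, ghf_eq_iInf_mismatch Q R]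
  simp only [ENNReal.iInf_add, ENNReal.add_iInf]
  exact le_iInf fun _ => le_iInf fun g' => le_iInf fun h =>
    le_iInf fun _ => le_iInf fun f => le_iInf fun g => hamalgam f g g' h

theorem continuous_mismatch (hF : F.PointwiseContinuous) (P Q : F.Pair) (Z : CompMet.{u}) :
    Continuous fun p : P.space.Hom Z × Q.space.Hom Z => P.mismatch Q p.1 p.2 :=
  CompMet.Hom.continuous_hausdorffEDist_range.max
    (((hF.continuous_map P.pt).comp continuous_fst).edist
      ((hF.continuous_map Q.pt).comp continuous_snd))

theorem dist_le_of_mismatch_lt {f : P.space.Hom Z} {g : Q.space.Hom Z} {c : ℝ≥0}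
    (h : P.mismatch Q f g < c) {z z' : Z} (hz : z ∈ range f ∪ range g)
    (hz' : z' ∈ range f ∪ range g) :
    dist z z' ≤ c + Metric.diam (univ : Set P.space) + c := by
  have hnear : ∀ z ∈ range f ∪ range g, ∃ x, dist z (f x) ≤ c := by
    rintro _ (⟨x, rfl⟩ | hz)
    · exact ⟨x, by simp⟩
    · obtain ⟨_, ⟨x, rfl⟩, hx⟩ := Metric.exists_edist_lt_of_hausdorffEDist_lt hz
        ((Metric.hausdorffEDist_comm ..).trans_lt ((le_max_left _ _).trans_lt h))
      refine ⟨x, ?_⟩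
      rw [edist_nndist, ENNReal.coe_lt_coe] at hx
      exact_mod_cast hx.le
  obtain ⟨x, hx⟩ := hnear z hz
  obtain ⟨x', hx'⟩ := hnear z' hz'
  calc dist z z' ≤ dist z (f x) + dist (f x) (f x') + dist (f x') z' := dist_triangle4 _ _ _ _
    _ ≤ c + Metric.diam (univ : Set P.space) + c := by
      rw [f.isometry.dist_eq, dist_comm (f x')]
      gcongr
      exact Metric.dist_le_diam_of_mem (Bornology.IsBounded.all _) (mem_univ _) (mem_univ _)

theorem exists_mismatch_eq_of_mismatch_lt {c : ℝ≥0} {f : P.space.Hom Z} {g : Q.space.Hom Z}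
    (h : P.mismatch Q f g < c) :
    ∃ (f' : P.space.Hom (CompMet.lipschitzSpace P.space Q.space
        (c + Metric.diam (univ : Set P.space) + c))) (g' : Q.space.Hom _),
      P.mismatch Q f' g' = P.mismatch Q f g := by
  obtain ⟨D, f', g', i, j, rfl, rfl⟩ := CompMet.exists_hom_lipschitzSpace f g
    fun z hz z' hz' => dist_le_of_mismatch_lt h hz hz'
  exact ⟨j.comp f', j.comp g', by rw [mismatch_comp, mismatch_comp]⟩

theorem exists_mismatch_eq_ghf (hF : F.PointwiseContinuous) (h : P.ghf Q ≠ ⊤) :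
    ∃ (Z : CompMet.{u}) (f : P.space.Hom Z) (g : Q.space.Hom Z), P.mismatch Q f g = P.ghf Q := by
  obtain ⟨c, hc, -⟩ := ENNReal.lt_iff_exists_nnreal_btwn.1 h.lt_top
  obtain ⟨Z, f, g, hfg⟩ := ghf_lt_iff.1 hc
  obtain ⟨f', g', -⟩ := exists_mismatch_eq_of_mismatch_lt hfg
  obtain ⟨⟨f₀, g₀⟩, -, hmin⟩ := isCompact_univ.exists_isMinOn ⟨(f', g'), mem_univ _⟩
    (continuous_mismatch hF P Q _).continuousOn
  refine ⟨_, f₀, g₀, le_antisymm (le_of_forall_gt fun ε hε => ?_) (ghf_le_mismatch _ _)⟩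
  obtain ⟨Z, f, g, hfg⟩ := ghf_lt_iff.1 (lt_min hε hc)
  obtain ⟨f', g', heq⟩ := exists_mismatch_eq_of_mismatch_lt (hfg.trans_le (min_le_right _ _))
  calc P.mismatch Q f₀ g₀ ≤ P.mismatch Q f' g' := hmin (mem_univ (f', g'))
    _ = P.mismatch Q f g := heq
    _ < ε := hfg.trans_le (min_le_left _ _)

theorem iso_of_ghf_eq_zero (hF : F.PointwiseContinuous) (h : P.ghf Q = 0) : P.Iso Q := by
  obtain ⟨Z, f, g, hfg⟩ := exists_mismatch_eq_ghf hF (h.trans_ne ENNReal.zero_ne_top)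
  obtain ⟨hrange, hpt⟩ := max_eq_bot.1 (hfg.trans h)
  have hfg' : range f = range g :=
    (f.isClosed_range.hausdorffEDist_zero_iff g.isClosed_range).1 hrange
  have hlift : g.comp (CompMet.Hom.lift g.isometry f.isometry hfg'.le) = f :=
    CompMet.Hom.ext fun x => CompMet.Hom.apply_lift ..
  have hsurj : Function.Surjective (CompMet.Hom.lift g.isometry f.isometry hfg'.le) := by
    exact fun y => (hfg'.ge (mem_range_self y)).imp fun x hx =>
      g.isometry.injective ((CompMet.Hom.apply_lift ..).trans hx)
  refine ⟨CompMet.Hom.equivOfSurjective _ hsurj, (F.isometry_map g).injective ?_⟩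
  rw [CompMet.Hom.ofEquiv_equivOfSurjective, ← F.map_comp, hlift, edist_eq_zero.1 hpt]

end Pair

/-! ### The metric space of classes of pointed pairs -/

instance (P : F.pointed.Pair) : Nonempty P.space := ⟨P.pt.1⟩

/-- The isomorphism class of a pair. -/
def Pair.toClass (P : F.Pair) : F.Classes := Quotient.mk _ P

noncomputable instance : PseudoEMetricSpace F.pointed.Classes where
  edist := Classes.ghf
  edist_self := Quotient.ind Pair.ghf_self
  edist_comm := Quotient.ind₂ Pair.ghf_comm
  edist_triangle x y z := Quotient.inductionOn₃ x y z fun P Q R => P.ghf_triangle Q R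

namespace Pair

/-- The points of the pointed space of `P` have distance at most `R` to the base point. -/
def Within (P : F.pointed.Pair) (R : ℝ≥0) : Prop := ∀ x, dist x P.pt.1 ≤ R

variable {P Q : F.pointed.Pair} {R η : ℝ≥0}

theorem Within.of_ghf_lt (hP : P.Within R) (h : P.ghf Q < η) : Q.Within (R + 2 * η) := by
  intro y
  obtain ⟨Z, f, g, hfg⟩ := ghf_lt_iff.1 h
  obtain ⟨_, ⟨x, rfl⟩, hx⟩ := Metric.exists_edist_lt_of_hausdorffEDist_lt (mem_range_self y)
    ((Metric.hausdorffEDist_comm ..).trans_lt ((le_max_left _ _).trans_lt hfg))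
  have ho : edist (f P.pt.1) (g Q.pt.1) < η :=
    ((le_max_left _ _).trans (le_max_right _ _)).trans_lt hfg
  rw [edist_nndist, ENNReal.coe_lt_coe, ← NNReal.coe_lt_coe, coe_nndist] at hx ho
  have htri := dist_triangle4 (g y) (f x) (f P.pt.1) (g Q.pt.1)
  rw [g.isometry.dist_eq, f.isometry.dist_eq] at htri
  have hxR := hP x
  push_cast
  linarith

end Pair

end MetFunctor

/-! ### Subtuples in terms of isometric embeddings -/

namespace PosMetFunctor.Truncation

variable {τ : PosMetFunctor.{u, v}}

theorem map_tmap_ofEquiv (t : τ.Truncation) {X Y : CompMet.{u}} (e : X ≃ᵢ Y) (b : τ.obj Y) :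
    τ.map (CompMet.Hom.ofEquiv e) (t.tmap (CompMet.Hom.ofEquiv e) b) = b := by
  have hcancel (c : τ.obj Y) :
      t.tmap (CompMet.Hom.ofEquiv e.symm) (t.tmap (CompMet.Hom.ofEquiv e) c) = c := by
    rw [← t.tmap_comp]
    convert t.tmap_id Y c using 2
    exact CompMet.Hom.ext e.apply_symm_apply
  rw [← hcancel (τ.map _ _), t.tmap_map, hcancel]

theorem iso_of_tmap_eq (t : τ.Truncation) {P Q : τ.pointed.Pair} (f : P.space.Hom Q.space)
    (hf : Function.Surjective f) (ho : f P.pt.1 = Q.pt.1) (ha : t.tmap f Q.pt.2 = P.pt.2) :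
    P.Iso Q :=
  ⟨f.equivOfSurjective hf, Prod.ext ho <|
    (congrArg (τ.map _) ha.symm).trans (t.map_tmap_ofEquiv (f.equivOfSurjective hf) Q.pt.2)⟩

theorem tmap_ofEquiv_of_map_eq (t : τ.Truncation) {X Y : CompMet.{u}} {e : X ≃ᵢ Y} {a : τ.obj X}
    {b : τ.obj Y} (h : τ.map (CompMet.Hom.ofEquiv e) a = b) :
    t.tmap (CompMet.Hom.ofEquiv e) b = a :=
  h ▸ t.tmap_map _ a

namespace Tuple

variable {t : τ.Truncation} {X Y : t.Tuple} {P Q : τ.pointed.Pair} {C : CompMet.{u}}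
  {g : C → Y.space} {r s R : ℝ≥0}

/-- The restriction of the family `a` of a tuple along an isometric embedding of a compact space. -/
def restr (Y : t.Tuple) {C : CompMet.{u}} {g : C → Y.space} (hg : Isometry g) : τ.obj C :=
  t.tmap (Y := CompMet.ofSet ⟨range g, isCompact_range hg.continuous⟩)
    ⟨fun x => ⟨g x, mem_range_self x⟩, hg⟩ (Y.a.val _)

theorem restr_eq_tmap_val (hg : Isometry g) (K : Compacts Y.space) (h : ∀ x, g x ∈ K) :
    Y.restr hg = t.tmap (Y := CompMet.ofSet K) ⟨fun x => ⟨g x, h x⟩, hg⟩ (Y.a.val K) := by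
  have hK : (⟨range g, isCompact_range hg.continuous⟩ : Compacts Y.space) ≤ K :=
    range_subset_iff.2 h
  rw [restr, ← Y.a.compat hK, ← t.tmap_comp]
  rfl

theorem tmap_restr (hg : Isometry g) {D : CompMet.{u}} (f : D.Hom C) :
    t.tmap f (Y.restr hg) = Y.restr (hg.comp f.isometry) := by
  rw [restr_eq_tmap_val _ ⟨range g, isCompact_range hg.continuous⟩ fun x => mem_range_self (f x),
    restr, ← t.tmap_comp]
  rfl

theorem restr_ofPair (g : C.Hom P.space) : (ofPair t P).restr g.isometry = t.tmap g P.pt.2 :=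
  (t.tmap_comp _ _ _).symm

theorem restr_subtype_val (K : Compacts Y.space) :
    Y.restr (C := CompMet.ofSet K) isometry_subtype_coe = Y.a.val K :=
  (restr_eq_tmap_val _ K fun x : CompMet.ofSet K => x.2).trans (t.tmap_id _ _)

theorem restr_ball (g : C.Hom (Y.ball R).toPair.space) :
    (ofPair t (Y.ball R).toPair).restr g.isometry =
      Y.restr (isometry_subtype_coe.comp g.isometry) := by
  rw [restr_ofPair, ← tmap_restr (C := (Y.ball R).toPair.space) (isometry_subtype_coe) g]
  exact congrArg (t.tmap g) (restr_subtype_val _).symm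

/-- The map `g` embeds the pair `P` as a compact tuple `P ⪯ Y`. -/
structure IsSubVia (Y : t.Tuple) (P : τ.pointed.Pair) (g : P.space → Y.space) : Prop where
  isometry : Isometry g
  map_base : g P.pt.1 = Y.o
  le : P.pt.2 ≤ Y.restr isometry

/-- The map `g` embeds the pair `P` as a compact tuple with `Y^(r) ⪯ P ⪯ Y`. The inequality between
the elements over the ball is stated for all isometric embeddings into the ball at once. -/
structure IsBetweenVia (Y : t.Tuple) (r : ℝ≥0) (P : τ.pointed.Pair) (g : P.space → Y.space) : Prop
    extends Y.IsSubVia P g where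
  closedBall_subset : Metric.closedBall Y.o r ⊆ range g
  restr_le : ∀ {C : CompMet.{u}} (h : C.Hom P.space), (∀ c, dist (h c) P.pt.1 ≤ r) →
    Y.restr (isometry.comp h.isometry) ≤ t.tmap h P.pt.2

/-- The pair `P` is isomorphic to a compact tuple `⪯ Y`. -/
def HasSub (Y : t.Tuple) (P : τ.pointed.Pair) : Prop := ∃ g, Y.IsSubVia P g

/-- The pair `P` is isomorphic to a compact tuple `Y'` with `Y^(r) ⪯ Y' ⪯ Y`. -/
def Between (Y : t.Tuple) (r : ℝ≥0) (P : τ.pointed.Pair) : Prop := ∃ g, Y.IsBetweenVia r P g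

theorem Between.hasSub (h : Y.Between r P) : Y.HasSub P :=
  h.imp fun _ hg => hg.toIsSubVia

theorem IsSubVia.comp {g : P.space → Y.space} {f : Q.space → P.space} (hg : Y.IsSubVia P g)
    (hf : (ofPair t P).IsSubVia Q f) : Y.IsSubVia Q (g ∘ f) where
  isometry := hg.isometry.comp hf.isometry
  map_base := (congrArg g hf.map_base).trans hg.map_base
  le :=
    calc Q.pt.2 ≤ (ofPair t P).restr hf.isometry := hf.le
      _ = t.tmap ⟨f, hf.isometry⟩ P.pt.2 := restr_ofPair ⟨f, hf.isometry⟩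
      _ ≤ t.tmap ⟨f, hf.isometry⟩ (Y.restr hg.isometry) := t.monotone_tmap _ hg.le
      _ = Y.restr (hg.isometry.comp hf.isometry) := tmap_restr hg.isometry ⟨f, hf.isometry⟩

theorem IsSubVia.dist_map_base {g : P.space → Y.space} (hg : Y.IsSubVia P g) (x : P.space) :
    dist (g x) Y.o = dist x P.pt.1 := by
  rw [← hg.map_base, hg.isometry.dist_eq]

theorem IsBetweenVia.comp {g : P.space → Y.space} {f : Q.space → P.space}
    (hg : Y.IsBetweenVia r P g) (hf : (ofPair t P).IsBetweenVia r Q f) :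
    Y.IsBetweenVia r Q (g ∘ f) where
  toIsSubVia := hg.toIsSubVia.comp hf.toIsSubVia
  closedBall_subset y hy := by
    obtain ⟨x, rfl⟩ := hg.closedBall_subset hy
    obtain ⟨z, rfl⟩ := hf.closedBall_subset ((hg.dist_map_base x).symm.trans_le hy)
    exact ⟨z, rfl⟩
  restr_le h hh := by
    refine (hg.restr_le (CompMet.Hom.comp ⟨f, hf.isometry⟩ h) fun c => ?_).trans ?_
    · exact (hf.dist_map_base (h c)).trans_le (hh c)
    · exact (restr_ofPair (CompMet.Hom.comp ⟨f, hf.isometry⟩ h)).symm.trans_le (hf.restr_le h hh)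

theorem HasSub.comp (h : Y.HasSub P) (h' : (ofPair t P).HasSub Q) : Y.HasSub Q :=
  let ⟨_, hg⟩ := h
  let ⟨_, hf⟩ := h'
  ⟨_, hg.comp hf⟩

theorem Between.comp (h : Y.Between r P) (h' : (ofPair t P).Between r Q) : Y.Between r Q :=
  let ⟨_, hg⟩ := h
  let ⟨_, hf⟩ := h'
  ⟨_, hg.comp hf⟩

theorem Between.mono (h : Y.Between r P) (hs : s ≤ r) : Y.Between s P := by
  obtain ⟨g, hg⟩ := h
  exact ⟨g, hg.toIsSubVia,
    (Metric.closedBall_subset_closedBall (NNReal.coe_le_coe.2 hs)).trans hg.closedBall_subset,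
    fun h hh => hg.restr_le h fun c => (hh c).trans (NNReal.coe_le_coe.2 hs)⟩

theorem between_of_iso (h : P.Iso Q) (r : ℝ≥0) : (ofPair t Q).Between r P := by
  obtain ⟨e, he⟩ := h
  have hrestr {C : CompMet.{u}} (h : C.Hom P.space) :
      (ofPair t Q).restr (e.isometry.comp h.isometry) = t.tmap h P.pt.2 := by
    refine (restr_ofPair ((CompMet.Hom.ofEquiv e).comp h)).trans ?_
    rw [t.tmap_comp, t.tmap_ofEquiv_of_map_eq (congrArg Prod.snd he)]
  refine ⟨e, ⟨e.isometry, congrArg Prod.fst he, ?_⟩, ?_, fun h _ => (hrestr h).le⟩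
  · exact ((hrestr (CompMet.Hom.id _)).trans (t.tmap_id _ _)).ge
  · exact fun y _ => e.surjective y

theorem HasSub.of_iso (h : Y.HasSub P) (hi : Q.Iso P) : Y.HasSub Q :=
  h.comp (between_of_iso hi 0).hasSub

theorem Between.of_iso (h : Y.Between r P) (hi : Q.Iso P) : Y.Between r Q :=
  h.comp (between_of_iso hi r)

theorem Sub.isSubVia (S : Y.Sub) : Y.IsSubVia S.toPair Subtype.val where
  isometry := isometry_subtype_coe
  map_base := rfl
  le := S.a_le.trans_eq (restr_subtype_val S.carrier).symm

theorem Sub.isBetweenVia {S : Y.Sub} (h : Y.ball r ≤ S) :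
    Y.IsBetweenVia r S.toPair Subtype.val where
  toIsSubVia := S.isSubVia
  closedBall_subset y hy := ⟨⟨y, h.1 hy⟩, rfl⟩
  restr_le {C} k hk := by
    let k' : C.Hom (CompMet.ofSet (Y.ball r).carrier) := ⟨fun c => ⟨(k c).1, hk c⟩, k.isometry⟩
    calc Y.restr (isometry_subtype_coe.comp k.isometry) = t.tmap k' (Y.ball r).a :=
          restr_eq_tmap_val _ _ hk
      _ ≤ t.tmap k' (t.tmap (CompMet.incl h.1) S.a) := t.monotone_tmap _ h.2
      _ = t.tmap k S.a := (t.tmap_comp _ _ _).symm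

theorem IsSubVia.exists_sub {g : P.space → Y.space} (hg : Y.IsSubVia P g) :
    ∃ S : Y.Sub, P.Iso S.toPair ∧ ∀ r, Y.IsBetweenVia r P g → Y.ball r ≤ S := by
  let K : Compacts Y.space := ⟨range g, isCompact_range hg.isometry.continuous⟩
  let e : P.space ≃ᵢ CompMet.ofSet K := hg.isometry.isometryEquivOnRange
  have hle : P.pt.2 ≤ t.tmap (CompMet.Hom.ofEquiv e) (Y.a.val K) := hg.le
  refine ⟨⟨K, ⟨_, hg.map_base⟩, τ.map (CompMet.Hom.ofEquiv e) P.pt.2,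
    (τ.monotone_map _ hle).trans (t.map_tmap_le _ _)⟩,
    ⟨e, Prod.ext (Subtype.ext hg.map_base) rfl⟩, fun r hr => ⟨hr.closedBall_subset, ?_⟩⟩
  let k : (Y.ball r).toPair.space.Hom P.space :=
    CompMet.Hom.lift hg.isometry isometry_subtype_coe
      (Subtype.range_coe.trans_subset hr.closedBall_subset)
  have hk (c : (Y.ball r).toPair.space) : g (k c) = c.1 := CompMet.Hom.apply_lift ..
  have hek : CompMet.incl hr.closedBall_subset = (CompMet.Hom.ofEquiv e).comp k :=
    CompMet.Hom.ext fun c => Subtype.ext (hk c).symm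
  have hrestr : Y.restr (hg.isometry.comp k.isometry) = (Y.ball r).a := by
    refine Eq.trans ?_ (restr_subtype_val _)
    congr 1
    exact funext hk
  refine hrestr.ge.trans ((hr.restr_le k fun c => ?_).trans_eq ?_)
  · rw [← hg.dist_map_base, hk]
    exact c.2
  · rw [hek]
    exact ((t.tmap_comp _ _ _).trans (congrArg (t.tmap k) (t.tmap_map _ _))).symm

theorem hasSub_iff : Y.HasSub P ↔ ∃ S : Y.Sub, P.Iso S.toPair := by
  refine ⟨fun ⟨g, hg⟩ => hg.exists_sub.imp fun S hS => hS.1, fun ⟨S, hS⟩ => ?_⟩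
  exact HasSub.of_iso ⟨_, S.isSubVia⟩ hS

theorem between_iff : Y.Between r P ↔ ∃ S : Y.Sub, Y.ball r ≤ S ∧ P.Iso S.toPair := by
  refine ⟨fun ⟨g, hg⟩ => ?_, fun ⟨S, hS, hi⟩ => Between.of_iso ⟨_, Sub.isBetweenVia hS⟩ hi⟩
  exact hg.exists_sub.imp fun S hS => ⟨hS.2 r hg, hS.1⟩

theorem between_ball (Y : t.Tuple) (h : r ≤ R) : Y.Between r (Y.ball R).toPair := by
  refine between_iff.2 ⟨Y.ball R, ⟨?_, (Y.a.compat _).ge⟩, .refl _⟩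
  exact Metric.closedBall_subset_closedBall (NNReal.coe_le_coe.2 h)

theorem Between.ball_iso (h : Y.Between r P) :
    ((ofPair t P).ball r).toPair.Iso (Y.ball r).toPair := by
  obtain ⟨g, hg⟩ := h
  let i : ((ofPair t P).ball r).toPair.space.Hom P.space := CompMet.inclSpace _
  have hmem (x : ((ofPair t P).ball r).toPair.space) : g (i x) ∈ (Y.ball r).carrier :=
    (hg.dist_map_base (i x)).trans_le x.2
  refine t.iso_of_tmap_eq ⟨fun x => ⟨g (i x), hmem x⟩, hg.isometry.comp i.isometry⟩ ?_
    (Subtype.ext hg.map_base) ?_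
  · rintro ⟨y, hy⟩
    obtain ⟨x, rfl⟩ := hg.closedBall_subset hy
    exact ⟨⟨x, (hg.dist_map_base x).symm.trans_le hy⟩, rfl⟩
  · refine (restr_eq_tmap_val (hg.isometry.comp i.isometry) _ hmem).symm.trans ?_
    refine le_antisymm (hg.restr_le i fun c => c.2) ?_
    rw [← tmap_restr hg.isometry i]
    exact t.monotone_tmap i hg.le

theorem Between.ball (h : Y.Between r P) : (ofPair t P).Between r (Y.ball r).toPair :=
  ((ofPair t P).between_ball le_rfl).of_iso h.ball_iso.symm

theorem within_ball (Y : t.Tuple) (R : ℝ≥0) : (Y.ball R).toPair.Within R :=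
  fun x => x.2

theorem IsSubVia.fit {g : P.space → Y.space} (hg : Y.IsSubVia P g) (hP : P.Within R) :
    ∃ g' : P.space.Hom (Y.ball R).toPair.space, (∀ x, (g' x).1 = g x) ∧
      (ofPair t (Y.ball R).toPair).IsSubVia P g' :=
  let g' : P.space.Hom (Y.ball R).toPair.space :=
    ⟨fun x => ⟨g x, (hg.dist_map_base x).trans_le (hP x)⟩, hg.isometry⟩
  ⟨g', fun _ => rfl, g'.isometry, Subtype.ext hg.map_base, hg.le.trans_eq (restr_ball g').symm⟩

theorem HasSub.fit (h : Y.HasSub P) (hP : P.Within R) :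
    (ofPair t (Y.ball R).toPair).HasSub P := by
  obtain ⟨g, hg⟩ := h
  obtain ⟨g', -, hg'⟩ := hg.fit hP
  exact ⟨g', hg'⟩

theorem Between.fit (h : Y.Between r P) (hP : P.Within R) :
    (ofPair t (Y.ball R).toPair).Between r P := by
  obtain ⟨g, hg⟩ := h
  obtain ⟨g', hg'g, hg'⟩ := hg.fit hP
  obtain rfl : (fun x => (g' x).1) = g := funext hg'g
  refine ⟨g', hg', fun y hy => ?_, fun h hh => ?_⟩
  · obtain ⟨x, hx⟩ := hg.closedBall_subset hy
    exact ⟨x, Subtype.ext hx⟩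
  · exact (restr_ball (g'.comp h)).trans_le (hg.restr_le h hh)

end Tuple

end PosMetFunctor.Truncation

namespace PosMetFunctor.Truncation

variable {τ : PosMetFunctor.{u, v}} {t : τ.Truncation}

theorem tmap_ofEquiv_eq_of_le (hrigid : τ.Rigid) {X : CompMet.{u}} {e : X ≃ᵢ X} {a : τ.obj X}
    (h : a ≤ t.tmap (CompMet.Hom.ofEquiv e) a) : t.tmap (CompMet.Hom.ofEquiv e) a = a :=
  t.tmap_ofEquiv_of_map_eq (hrigid X e a ((τ.monotone_map _ h).trans (t.map_tmap_le _ _)))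

namespace Tuple

variable {Y : t.Tuple} {P Q P' : τ.pointed.Pair} {r s : ℝ≥0}

theorem IsSubVia.isBetweenVia_ball (hrigid : τ.Rigid) {g : (Y.ball r).toPair.space → Y.space}
    (hg : Y.IsSubVia (Y.ball r).toPair g) : Y.IsBetweenVia r (Y.ball r).toPair g := by
  let B := (Y.ball r).toPair.space
  have hmem (x : B) : g x ∈ (Y.ball r).carrier := (hg.dist_map_base x).trans_le x.2
  let f : B.Hom B := ⟨fun x => ⟨g x, hmem x⟩, hg.isometry⟩
  let e : B ≃ᵢ B := f.equivOfSurjective (surjective_of_isometry_of_compactSpace f.isometry)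
  have he : t.tmap (CompMet.Hom.ofEquiv e) (Y.ball r).a = (Y.ball r).a :=
    tmap_ofEquiv_eq_of_le hrigid (hg.le.trans_eq (restr_eq_tmap_val _ _ hmem))
  refine ⟨hg, fun y hy => ?_, fun h _ => ?_⟩
  · obtain ⟨x, hx⟩ := e.surjective ⟨y, hy⟩
    exact ⟨x, congrArg Subtype.val hx⟩
  · calc Y.restr (hg.isometry.comp h.isometry)
      _ = t.tmap ((CompMet.Hom.ofEquiv e).comp h) (Y.ball r).a :=
          restr_eq_tmap_val _ _ fun c => hmem (h c)
      _ = t.tmap h (t.tmap (CompMet.Hom.ofEquiv e) (Y.ball r).a) := t.tmap_comp _ _ _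
      _ ≤ t.tmap h (Y.ball r).a := (congrArg (t.tmap h) he).le

theorem IsSubVia.isBetweenVia_of_comp {g : P.space → Y.space} {f : Q.space → P.space}
    (hg : Y.IsSubVia P g) (hf : (ofPair t P).IsSubVia Q f) (hgf : Y.IsBetweenVia r Q (g ∘ f)) :
    Y.IsBetweenVia r P g where
  toIsSubVia := hg
  closedBall_subset := hgf.closedBall_subset.trans (range_comp_subset_range f g)
  restr_le {C} h hh := by
    have hrange : range h ⊆ range f := by
      rintro _ ⟨c, rfl⟩
      obtain ⟨x, hx⟩ := hgf.closedBall_subset ((hg.dist_map_base (h c)).trans_le (hh c))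
      exact ⟨x, hg.isometry.injective hx⟩
    obtain ⟨k, rfl⟩ : ∃ k : C.Hom Q.space, CompMet.Hom.comp ⟨f, hf.isometry⟩ k = h :=
      ⟨CompMet.Hom.lift hf.isometry h.isometry hrange, CompMet.Hom.ext fun _ =>
        CompMet.Hom.apply_lift ..⟩
    have hk (c : C) : dist (k c) Q.pt.1 ≤ r := (hf.dist_map_base (k c)).symm.trans_le (hh c)
    calc Y.restr (hgf.isometry.comp k.isometry)
      _ ≤ t.tmap k Q.pt.2 := hgf.restr_le k hk
      _ ≤ t.tmap k (t.tmap ⟨f, hf.isometry⟩ P.pt.2) :=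
          t.monotone_tmap k (hf.le.trans_eq (restr_ofPair ⟨f, hf.isometry⟩))
      _ = t.tmap (CompMet.Hom.comp ⟨f, hf.isometry⟩ k) P.pt.2 := (t.tmap_comp _ _ _).symm

theorem HasSub.between_of_hasSub_ball (hrigid : τ.Rigid) (h : Y.HasSub P)
    (h' : (ofPair t P).HasSub (Y.ball r).toPair) : Y.Between r P := by
  obtain ⟨g, hg⟩ := h
  obtain ⟨f, hf⟩ := h'
  exact ⟨g, hg.isBetweenVia_of_comp hf ((hg.comp hf).isBetweenVia_ball hrigid)⟩

theorem HasSub.exists_ghf_le (hsub : t.SubtupleApprox) (h : (ofPair t P).HasSub P')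
    (Q : τ.pointed.Pair) : ∃ Q', (ofPair t Q).HasSub Q' ∧ P'.ghf Q' ≤ P.ghf Q := by
  obtain ⟨S, hS⟩ := hasSub_iff.1 h
  obtain ⟨S', hS'⟩ := hsub P Q S
  exact ⟨S'.toPair, ⟨_, S'.isSubVia⟩, (MetFunctor.Pair.ghf_congr hS (.refl _)).trans_le hS'⟩

theorem Between.exists_ghf_lt (hsubBall : t.SubtupleApproxBall) {η : ℝ≥0} (hQ : Y.Between s Q)
    (hPQ : P.ghf Q < η) (hP' : (ofPair t P).Between r P') (hs : s + 2 * η ≤ r) :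
    ∃ Q', Y.Between s Q' ∧ P'.ghf Q' < η := by
  obtain ⟨S, hrS, hS⟩ := between_iff.1 hP'
  obtain ⟨ε, hε⟩ : ∃ ε : ℝ≥0, ε = P.ghf Q := ⟨_, ENNReal.coe_toNNReal hPQ.ne_top⟩
  have hεη : ε ≤ η := ENNReal.coe_le_coe.1 (hε.trans_le hPQ.le)
  have hεr : s + 2 * ε ≤ r := le_trans (by gcongr) hs
  obtain ⟨S', hrS', hS'⟩ := hsubBall P Q S ε r hε.symm (le_of_add_le_right hεr) hrS
  have hQS' : (ofPair t Q).Between s S'.toPair :=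
    Between.mono ⟨_, Sub.isBetweenVia hrS'⟩ (le_tsub_of_add_le_right hεr)
  refine ⟨S'.toPair, hQ.comp hQS', ?_⟩
  exact ((MetFunctor.Pair.ghf_congr hS (.refl _)).trans_le hS').trans_lt hPQ

end Tuple

end PosMetFunctor.Truncation

/-! ### Compactness of the set of subtuples -/

theorem CompMet.range_inclSpace {X : CompMet.{u}} (S : Compacts X) : range (inclSpace S) = S :=
  Subtype.range_coe

namespace MetFunctor

variable {F : MetFunctor.{u, v}}

theorem HausdorffClosed.isClosed_setOf_mem_range (hF : F.HausdorffClosed) (Z : CompMet.{u}) :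
    IsClosed {p : Compacts Z × F.obj Z | p.2 ∈ range (F.map (CompMet.inclSpace p.1))} := by
  refine IsSeqClosed.isClosed fun p q hp hpq => ?_
  choose a ha using hp
  refine hF Z _ _ _ (fun n => CompMet.inclSpace (p n).1) ?_ q.2 a ?_
  · have hK := tendsto_iff_edist_tendsto_0.1 ((continuous_fst.tendsto q).comp hpq)
    simpa only [CompMet.range_inclSpace] using! hK
  · simpa only [ha] using! (continuous_snd.tendsto q).comp hpq

end MetFunctor

namespace PosMetFunctor.Truncation.Tuple

variable {τ : PosMetFunctor.{u, v}} {t : τ.Truncation} {P Q : τ.pointed.Pair}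

/-- The carrier of a subtuple of a compact tuple, and the image of its element in `τ` of the whole
space. This determines the subtuple. -/
def Sub.toProd (S : (ofPair t P).Sub) : Compacts P.space × τ.obj P.space :=
  (S.carrier, τ.map (CompMet.inclSpace S.carrier) S.a)

theorem Sub.range_toProd : range (Sub.toProd : (ofPair t P).Sub → _) =
    {p | P.pt.1 ∈ p.1} ∩ {p | p.2 ∈ range (τ.map (CompMet.inclSpace p.1))} ∩
      {p | p.2 ≤ P.pt.2} := by
  ext ⟨K, b⟩
  constructor
  · rintro ⟨S, hS⟩
    obtain ⟨rfl, rfl⟩ := Prod.ext_iff.1 hS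
    exact ⟨⟨S.o_mem, _, rfl⟩, (τ.monotone_map _ S.a_le).trans (t.map_tmap_le _ _)⟩
  · rintro ⟨⟨ho, a, ha⟩, hle⟩
    exact ⟨⟨K, ho, a, (t.tmap_map _ a).symm.trans_le (t.monotone_tmap _ (ha.trans_le hle))⟩,
      Prod.ext rfl ha⟩

theorem Sub.isCompact_range_toProd (hclosed : τ.HausdorffClosed) :
    IsCompact (range (Sub.toProd : (ofPair t P).Sub → _)) := by
  have hbase : IsClosed {K : Compacts P.space | P.pt.1 ∈ K} := by
    simpa only [inter_singleton_nonempty, SetLike.mem_coe] using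
      Compacts.isClosed_inter_nonempty_of_isClosed (isClosed_singleton (x := P.pt.1))
  have hcone : IsCompact ((univ : Set (Compacts P.space)) ×ˢ {b | b ≤ P.pt.2}) :=
    isCompact_univ.prod (τ.isCompact_cone P.space P.pt.2)
  rw [Sub.range_toProd]
  simpa only [univ_prod] using!
    hcone.inter_left ((hbase.preimage continuous_fst).inter (hclosed.isClosed_setOf_mem_range _))

theorem Sub.edist_toClass_le (S S' : (ofPair t P).Sub) :
    edist S.toClass S'.toClass ≤ edist S.toProd S'.toProd := by
  let f := CompMet.inclSpace S.carrier
  let f' := CompMet.inclSpace S'.carrier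
  refine (MetFunctor.Pair.ghf_le_mismatch (P := S.toPair) (Q := S'.toPair) f f').trans ?_
  refine max_le ?_ (max_le ?_ (le_max_right _ _))
  · refine (congrArg₂ Metric.hausdorffEDist ?_ ?_).trans_le (le_max_left _ _) <;>
      exact CompMet.range_inclSpace _
  · exact (edist_self P.pt.1).trans_le bot_le

theorem Sub.isCompact_range_toClass (hclosed : τ.HausdorffClosed) :
    IsCompact (range (Sub.toClass : (ofPair t P).Sub → τ.pointed.Classes)) := by
  let _ : PseudoEMetricSpace (ofPair t P).Sub := PseudoEMetricSpace.induced Sub.toProd inferInstance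
  have hind : IsInducing (Sub.toProd : (ofPair t P).Sub → _) := ⟨rfl⟩
  have hlip : LipschitzWith 1 (Sub.toClass : (ofPair t P).Sub → τ.pointed.Classes) :=
    LipschitzWith.of_edist_le Sub.edist_toClass_le
  rw [← image_univ]
  refine IsCompact.image (hind.isCompact_iff.2 ?_) hlip.continuous
  rw [image_univ]
  exact Sub.isCompact_range_toProd hclosed

theorem hasSub_of_tendsto (hcont : τ.PointwiseContinuous) (hsub : t.SubtupleApprox)
    (hclosed : τ.HausdorffClosed) {ι : Type*} {l : Filter ι} [NeBot l] {p q : ι → τ.pointed.Pair}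
    (hp : Tendsto (fun i => (p i).toClass) l (𝓝 P.toClass))
    (hq : Tendsto (fun i => (q i).toClass) l (𝓝 Q.toClass))
    (h : ∀ᶠ i in l, (ofPair t (p i)).HasSub (q i)) : (ofPair t P).HasSub Q := by
  have hmem : Q.toClass ∈ closure (range (Sub.toClass : (ofPair t P).Sub → τ.pointed.Classes)) := by
    refine EMetric.mem_closure_iff.2 fun ε hε => ?_
    have hε2 : 0 < ε / 2 := ENNReal.half_pos hε.ne'
    obtain ⟨i, hi, hpi, hqi⟩ :=
      (h.and ((EMetric.tendsto_nhds.1 hp _ hε2).and (EMetric.tendsto_nhds.1 hq _ hε2))).exists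
    obtain ⟨R, hR, hqR⟩ := hi.exists_ghf_le hsub P
    obtain ⟨S, hS⟩ := hasSub_iff.1 hR
    refine ⟨S.toClass, ⟨S, rfl⟩, ?_⟩
    calc edist Q.toClass S.toClass = edist Q.toClass R.toClass := by
          rw [← show R.toClass = S.toClass from Quotient.sound hS]
      _ ≤ edist Q.toClass (q i).toClass + edist (q i).toClass R.toClass := edist_triangle _ _ _
      _ < ε / 2 + ε / 2 :=
          ENNReal.add_lt_add ((edist_comm _ _).trans_lt hqi) (LE.le.trans_lt hqR hpi)
      _ = ε := ENNReal.add_halves ε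
  rw [(Sub.isCompact_range_toClass hclosed).closure_eq_biUnion_inseparable] at hmem
  obtain ⟨_, ⟨S, rfl⟩, hS⟩ := mem_iUnion₂.1 hmem
  have hQS : Q.ghf S.toPair = 0 := EMetric.inseparable_iff.1 (Inseparable.symm hS)
  exact hasSub_iff.2 ⟨S, MetFunctor.Pair.iso_of_ghf_eq_zero hcont.pointed hQS⟩

end PosMetFunctor.Truncation.Tuple

/-! ### The distance of tuples -/

theorem one_div_add_add_le_one_div {ε δ : ℝ≥0} (hδ : 0 < δ) (h : ε + δ ≤ 1) :
    1 / (ε + δ) + ε ≤ 1 / δ := by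
  have hsum : 0 < ε + δ := hδ.trans_le le_add_self
  have hprod : δ * (ε + δ) ≤ 1 := mul_le_one' (le_add_self.trans h) h
  calc 1 / (ε + δ) + ε ≤ 1 / (ε + δ) + ε / (δ * (ε + δ)) := by
        gcongr
        exact (le_div_iff₀ (mul_pos hδ hsum)).2 (mul_le_of_le_one_right' hprod)
    _ = 1 / δ := by field_simp; ring

namespace PosMetFunctor.Truncation

variable {τ : PosMetFunctor.{u, v}} {t : τ.Truncation}

namespace Tuple

variable {X Y Z : t.Tuple} {ε δ : ℝ≥0}

/-- The inequality `a_ε(X, Y) < ε / 2` from the definition of the distance of tuples. -/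
def IsApprox (ε : ℝ≥0) (X Y : t.Tuple) : Prop :=
  ∃ P, Y.Between (1 / ε - ε) P ∧ (X.ball (1 / ε)).toPair.ghf P < (ε / 2 : ℝ≥0)

theorem approx_lt_half_iff : approx ε X Y < (ε : ℝ≥0∞) / 2 ↔ IsApprox ε X Y := by
  have hcoe : ((ε / 2 : ℝ≥0) : ℝ≥0∞) = (ε : ℝ≥0∞) / 2 := by simp
  simp only [approx, iInf_lt_iff, IsApprox, between_iff, hcoe]
  constructor
  · exact fun ⟨S, hS, h⟩ => ⟨_, ⟨S, hS, .refl _⟩, h⟩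
  · exact fun ⟨P, ⟨S, hS, hi⟩, h⟩ =>
      ⟨S, hS, (MetFunctor.Pair.ghf_congr (.refl _) hi).symm.trans_lt h⟩

theorem isApprox_self (hε : 0 < ε) (X : t.Tuple) : IsApprox ε X X :=
  ⟨_, X.between_ball tsub_le_self, by
    rw [MetFunctor.Pair.ghf_self]
    exact ENNReal.coe_pos.2 (half_pos hε)⟩

theorem IsApprox.trans (hsubBall : t.SubtupleApproxBall) (hε : 0 < ε) (hδ : 0 < δ)
    (hsum : ε + δ ≤ 1) (hXY : IsApprox ε X Y) (hYZ : IsApprox δ Y Z) : IsApprox (ε + δ) X Z := by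
  obtain ⟨P, hP, hXP⟩ := hXY
  obtain ⟨Q, hQ, hYQ⟩ := hYZ
  set ρ := 1 / (ε + δ) with hρ
  have hρε : ρ + δ ≤ 1 / ε := by
    rw [hρ, add_comm ε]
    exact one_div_add_add_le_one_div hε (add_comm ε δ ▸ hsum)
  have hρδ : ρ + ε ≤ 1 / δ := one_div_add_add_le_one_div hδ hsum
  have hle : ε + δ ≤ ρ := hsum.trans ((one_le_div (add_pos hε hδ)).2 hsum)
  obtain ⟨X', hX', hXX'⟩ := (hP.mono (tsub_le_tsub_right (le_of_add_le_left hρε) ε)).exists_ghf_lt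
    hsubBall hXP (X.between_ball (le_of_add_le_left hρε)).ball (by
      rw [mul_div_cancel₀ _ two_ne_zero, tsub_add_cancel_of_le (le_of_add_le_left hle)])
  have hfit : (ofPair t (Y.ball (1 / δ)).toPair).Between (ρ - ε) X' := by
    refine hX'.fit fun x => ((within_ball X ρ).of_ghf_lt hXX' x).trans ?_
    rw [mul_div_cancel₀ _ two_ne_zero]
    exact NNReal.coe_le_coe.2 hρδ
  obtain ⟨X'', hX'', hX'X''⟩ := (hQ.mono (tsub_le_tsub (le_of_add_le_left hρδ)
    (le_add_self : δ ≤ ε + δ))).exists_ghf_lt hsubBall hYQ hfit (by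
      rw [mul_div_cancel₀ _ two_ne_zero]
      refine le_tsub_of_add_le_right ?_
      rw [add_assoc, add_comm δ, tsub_add_cancel_of_le hle])
  refine ⟨X'', hX'', (MetFunctor.Pair.ghf_triangle _ X' _).trans_lt ?_⟩
  rw [add_div, ENNReal.coe_add]
  exact ENNReal.add_lt_add hXX' hX'X''

theorem distance_le_one (X Y : t.Tuple) : distance X Y ≤ 1 :=
  csInf_le (OrderBot.bddBelow _) (mem_insert _ _)

theorem distance_le (hε : 0 < ε) (hXY : IsApprox ε X Y) (hYX : IsApprox ε Y X) :
    distance X Y ≤ ε := by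
  rcases le_total ε 1 with hε1 | hε1
  · exact csInf_le (OrderBot.bddBelow _)
      (Or.inr ⟨hε, hε1, max_lt (approx_lt_half_iff.2 hXY) (approx_lt_half_iff.2 hYX)⟩)
  · exact (distance_le_one X Y).trans hε1

theorem exists_isApprox_of_distance_lt (hε : ε ≤ 1) (h : distance X Y < ε) :
    ∃ δ, 0 < δ ∧ δ < ε ∧ IsApprox δ X Y ∧ IsApprox δ Y X := by
  obtain ⟨δ, rfl | ⟨hδ, -, hXY⟩, hδε⟩ := exists_lt_of_csInf_lt (insert_nonempty _ _) h
  · exact absurd hδε hε.not_gt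
  · obtain ⟨hXY, hYX⟩ := max_lt_iff.1 hXY
    exact ⟨δ, hδ, hδε, approx_lt_half_iff.1 hXY, approx_lt_half_iff.1 hYX⟩

theorem distance_self (X : t.Tuple) : distance X X = 0 :=
  bot_unique <| le_of_forall_gt_imp_ge_of_dense fun _ hε =>
    distance_le hε (isApprox_self hε X) (isApprox_self hε X)

theorem distance_comm (X Y : t.Tuple) : distance X Y = distance Y X := by
  simp only [distance, max_comm]

theorem distance_triangle (hsubBall : t.SubtupleApproxBall) (X Y Z : t.Tuple) :
    distance X Z ≤ distance X Y + distance Y Z := by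
  refine le_of_forall_pos_le_add fun κ hκ => ?_
  set c := distance X Y + distance Y Z + κ with hc
  rcases le_or_gt 1 c with hc1 | hc1
  · exact (distance_le_one X Z).trans hc1
  have hsplit : (distance X Y + κ / 2) + (distance Y Z + κ / 2) = c := by
    rw [hc, add_add_add_comm, add_halves]
  obtain ⟨ε, hε, hεc, hXY, hYX⟩ := exists_isApprox_of_distance_lt
    ((le_add_right le_rfl).trans (hsplit.trans_le hc1.le)) (lt_add_of_pos_right _ (half_pos hκ))
  obtain ⟨δ, hδ, hδc, hYZ, hZY⟩ := exists_isApprox_of_distance_lt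
    ((le_add_left le_rfl).trans (hsplit.trans_le hc1.le)) (lt_add_of_pos_right _ (half_pos hκ))
  have hεδ : ε + δ < c := (add_lt_add hεc hδc).trans_eq hsplit
  refine (distance_le (add_pos hε hδ) ?_ ?_).trans hεδ.le
  · exact hXY.trans hsubBall hε hδ (hεδ.trans hc1).le hYZ
  · rw [add_comm] at hεδ ⊢
    exact hZY.trans hsubBall hδ hε (hεδ.trans hc1).le hYX

end Tuple

/-- The pseudo-metric on the set of isomorphism classes of tuples. -/
noncomputable abbrev Classes.pseudoEMetricSpace (hsubBall : t.SubtupleApproxBall) :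
    PseudoEMetricSpace t.Classes where
  edist x y := x.distance y
  edist_self := Quotient.ind fun X => ENNReal.coe_eq_zero.2 X.distance_self
  edist_comm := Quotient.ind₂ fun X Y => congrArg _ (X.distance_comm Y)
  edist_triangle x y z := Quotient.inductionOn₃ x y z fun X Y Z =>
    mod_cast Tuple.distance_triangle hsubBall X Y Z

end PosMetFunctor.Truncation

/-! ### The direct limit of a chain of balls -/

theorem exists_nat_subset_closedBall {X : Type*} [PseudoMetricSpace X] {s : Set X}
    (hs : Bornology.IsBounded s) (x : X) : ∃ k : ℕ, s ⊆ Metric.closedBall x k := by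
  obtain ⟨r, hr⟩ := hs.subset_closedBall x
  obtain ⟨k, hk⟩ := exists_nat_ge r
  exact ⟨k, hr.trans (Metric.closedBall_subset_closedBall hk)⟩

section InductiveLimit

variable {X : ℕ → Type u} [∀ n, MetricSpace (X n)] {f : ∀ n, X n → X (n + 1)}
  (I : ∀ n, Isometry (f n)) {o : ∀ n, X n}

theorem toInductiveLimit_succ_apply (n : ℕ) (x : X n) :
    Metric.toInductiveLimit I (n + 1) (f n x) = Metric.toInductiveLimit I n x :=
  congrFun (Metric.toInductiveLimit_commute I n) x

theorem toInductiveLimit_base (ho : ∀ n, f n (o n) = o (n + 1)) (n : ℕ) :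
    Metric.toInductiveLimit I n (o n) = Metric.toInductiveLimit I 0 (o 0) := by
  induction n with
  | zero => rfl
  | succ n ih => rw [← ho, toInductiveLimit_succ_apply, ih]

theorem range_toInductiveLimit_eq_closedBall (ho : ∀ n, f n (o n) = o (n + 1))
    (hf : ∀ n : ℕ, range (f n) = Metric.closedBall (o (n + 1)) n) (n : ℕ) :
    range (Metric.toInductiveLimit I n) =
      Metric.closedBall (Metric.toInductiveLimit I 0 (o 0)) n := by
  have hdist (m : ℕ) (x : X m) :
      dist (Metric.toInductiveLimit I m x) (Metric.toInductiveLimit I 0 (o 0)) = dist x (o m) := by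
    rw [← toInductiveLimit_base I ho m, (Metric.toInductiveLimit_isometry I m).dist_eq]
  refine Subset.antisymm (range_subset_iff.2 fun x => ?_) fun x hx => ?_
  · rw [← toInductiveLimit_succ_apply I n x, Metric.mem_closedBall, hdist]
    exact (hf n).le (mem_range_self x)
  obtain ⟨m, x, rfl⟩ : ∃ m x', Metric.toInductiveLimit I m x' = x :=
    let ⟨⟨m, x'⟩, h⟩ := Quotient.exists_rep x
    ⟨m, x', h⟩
  rcases le_total m n with hmn | hnm
  · have hmono : Monotone fun n => range (Metric.toInductiveLimit I n) :=
      monotone_nat_of_le_succ fun n =>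
        range_subset_iff.2 fun x => ⟨_, toInductiveLimit_succ_apply I n x⟩
    exact hmono hmn (mem_range_self x)
  induction m, hnm using Nat.le_induction with
  | base => exact mem_range_self x
  | succ m hnm ih =>
    rw [Metric.mem_closedBall, hdist] at hx
    obtain ⟨y, rfl⟩ := (hf m).ge (hx.trans (Nat.cast_le.2 hnm))
    rw [toInductiveLimit_succ_apply I]
    exact ih y ((hdist m y).trans_le (((I m).dist_eq y (o m)).symm.trans_le (ho m ▸ hx)))

end InductiveLimit

namespace PosMetFunctor.Truncation.Tuple

variable {τ : PosMetFunctor.{u, v}} {t : τ.Truncation} {B : ℕ → τ.pointed.Pair}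

/-- A presentation of the closed balls with centre `o` and radius `k = 0, 1, …` of the metric space
`X` as isometric images of the pairs `B k`, compatible with truncation. -/
structure Exhaustion (t : τ.Truncation) (B : ℕ → τ.pointed.Pair) (X : Type u) [MetricSpace X]
    (o : X) where
  map : ∀ k, (B k).space → X
  isometry : ∀ k, Isometry (map k)
  map_base : ∀ k, map k (B k).pt.1 = o
  range_map : ∀ k : ℕ, range (map k) = Metric.closedBall o k
  tmap_of_map_eq : ∀ k (h : (B k).space.Hom (B (k + 1)).space),
    (∀ x, map (k + 1) (h x) = map k x) → t.tmap h (B (k + 1)).pt.2 = (B k).pt.2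

namespace Exhaustion

variable {X : Type u} [MetricSpace X] {o : X} (E : Exhaustion t B X o) {C : CompMet.{u}} {g : C → X}
  {k m : ℕ}

include E in
theorem properSpace : ProperSpace X := by
  refine .of_isCompact_closedBall_of_le 0 fun x r _ => ?_
  obtain ⟨k, hk⟩ := exists_nat_ge (r + dist x o)
  refine (isCompact_range (E.isometry k).continuous).of_isClosed_subset
    Metric.isClosed_closedBall ?_
  rw [E.range_map]
  exact Metric.closedBall_subset_closedBall' hk

/-- The lift of an isometric embedding into the ball of radius `k` to the pair presenting it. -/
noncomputable def lift (hg : Isometry g) (hk : range g ⊆ Metric.closedBall o k) :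
    C.Hom (B k).space :=
  CompMet.Hom.lift (E.isometry k) hg (hk.trans_eq (E.range_map k).symm)

theorem map_lift (hg : Isometry g) (hk : range g ⊆ Metric.closedBall o k) (c : C) :
    E.map k (E.lift hg hk c) = g c :=
  CompMet.Hom.apply_lift ..

theorem lift_unique (hg : Isometry g) (hk : range g ⊆ Metric.closedBall o k)
    (h : C.Hom (B k).space) (hh : ∀ c, E.map k (h c) = g c) : E.lift hg hk = h :=
  CompMet.Hom.ext fun c => (E.isometry k).injective ((E.map_lift hg hk c).trans (hh c).symm)

theorem tmap_lift_eq_of_le (hg : Isometry g) (hk : range g ⊆ Metric.closedBall o k) (hkm : k ≤ m)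
    (hm : range g ⊆ Metric.closedBall o m) :
    t.tmap (E.lift hg hm) (B m).pt.2 = t.tmap (E.lift hg hk) (B k).pt.2 := by
  induction m, hkm using Nat.le_induction with
  | base => rfl
  | succ m hkm ih =>
    have hm' : range g ⊆ Metric.closedBall o m :=
      hk.trans (Metric.closedBall_subset_closedBall (Nat.cast_le.2 hkm))
    let s := E.lift (E.isometry m) ((E.range_map m).trans_subset
      (Metric.closedBall_subset_closedBall (Nat.cast_le.2 m.le_succ)))
    have hs := E.map_lift (E.isometry m) ((E.range_map m).trans_subset
      (Metric.closedBall_subset_closedBall (Nat.cast_le.2 m.le_succ)))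
    have hlift : E.lift hg hm = s.comp (E.lift hg hm') :=
      E.lift_unique hg hm _ fun c => (hs _).trans (E.map_lift hg hm' c)
    rw [hlift, t.tmap_comp, E.tmap_of_map_eq m s hs, ih hm']

theorem tmap_lift_eq (hg : Isometry g) (hk : range g ⊆ Metric.closedBall o k)
    (hm : range g ⊆ Metric.closedBall o m) :
    t.tmap (E.lift hg hm) (B m).pt.2 = t.tmap (E.lift hg hk) (B k).pt.2 := by
  rcases le_total k m with h | h
  · exact E.tmap_lift_eq_of_le hg hk h hm
  · exact (E.tmap_lift_eq_of_le hg hm h hk).symm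

theorem exists_ext : ∃ a : t.Ext X, ∀ (Y : Compacts X) (k : ℕ)
    (h : range (Subtype.val : CompMet.ofSet Y → X) ⊆ Metric.closedBall o k),
    a.val Y = t.tmap (E.lift isometry_subtype_coe h) (B k).pt.2 := by
  choose n hn using fun Y : Compacts X => exists_nat_subset_closedBall Y.isCompact.isBounded o
  have hn' (Y : Compacts X) :
      range (Subtype.val : CompMet.ofSet Y → X) ⊆ Metric.closedBall o (n Y) :=
    Subtype.range_coe.trans_subset (hn Y)
  refine ⟨⟨fun Y => t.tmap (E.lift isometry_subtype_coe (hn' Y)) (B (n Y)).pt.2, ?_⟩,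
    fun Y k h => E.tmap_lift_eq _ h (hn' Y)⟩
  intro Y Y' h
  have hY : range (Subtype.val : CompMet.ofSet Y → X) ⊆ Metric.closedBall o (n Y') :=
    Subtype.range_coe.trans_subset (Subset.trans h (hn Y'))
  have hlift : E.lift isometry_subtype_coe hY =
      (E.lift isometry_subtype_coe (hn' Y')).comp (CompMet.incl h) :=
    E.lift_unique _ hY _ fun c => E.map_lift isometry_subtype_coe (hn' Y') (CompMet.incl h c)
  calc t.tmap (CompMet.incl h) (t.tmap (E.lift isometry_subtype_coe (hn' Y')) (B (n Y')).pt.2)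
    _ = t.tmap (E.lift isometry_subtype_coe hY) (B (n Y')).pt.2 := by
        rw [hlift, t.tmap_comp]
    _ = t.tmap (E.lift isometry_subtype_coe (hn' Y)) (B (n Y)).pt.2 :=
        E.tmap_lift_eq _ (hn' Y) hY

include E in
theorem exists_tuple : ∃ X : t.Tuple, ∀ k : ℕ, (X.ball k).toPair.Iso (B k) := by
  obtain ⟨a, ha⟩ := E.exists_ext
  have := E.properSpace
  let Y : t.Tuple := { space := X, o := o, a := a }
  refine ⟨Y, fun k => ?_⟩
  have hk : range (Subtype.val : CompMet.ofSet (Y.ball k).carrier → X) ⊆ Metric.closedBall o k :=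
    Subtype.range_coe.subset
  refine t.iso_of_tmap_eq (E.lift isometry_subtype_coe hk) (fun y => ?_) ?_ (ha _ k hk).symm
  · have hy : E.map k y ∈ Metric.closedBall o k := E.range_map k ▸ mem_range_self y
    exact ⟨⟨E.map k y, hy⟩, (E.isometry k).injective (E.map_lift ..)⟩
  · exact (E.isometry k).injective ((E.map_lift ..).trans (E.map_base k).symm)

end Exhaustion

theorem exists_exhaustion (s : ∀ k, (B k).space.Hom (B (k + 1)).space)
    (hbase : ∀ k, s k (B k).pt.1 = (B (k + 1)).pt.1)
    (hrange : ∀ k : ℕ, range (s k) = Metric.closedBall (B (k + 1)).pt.1 k)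
    (hpt : ∀ k, t.tmap (s k) (B (k + 1)).pt.2 = (B k).pt.2) :
    ∃ (X : Type u) (_ : MetricSpace X) (o : X), Nonempty (Exhaustion t B X o) := by
  have I (k : ℕ) : Isometry (s k) := (s k).isometry
  refine ⟨Metric.InductiveLimit I, inferInstance, Metric.toInductiveLimit I 0 (B 0).pt.1,
    ⟨⟨Metric.toInductiveLimit I, Metric.toInductiveLimit_isometry I,
      toInductiveLimit_base (o := fun k => (B k).pt.1) I hbase,
      range_toInductiveLimit_eq_closedBall (o := fun k => (B k).pt.1) I hbase hrange, ?_⟩⟩⟩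
  intro k h hh
  obtain rfl : h = s k := CompMet.Hom.ext fun x =>
    (Metric.toInductiveLimit_isometry I (k + 1)).injective <|
      (hh x).trans (toInductiveLimit_succ_apply I k x).symm
  exact hpt k

theorem exists_tuple_of_ball_iso
    (hB : ∀ k : ℕ, ((ofPair t (B (k + 1))).ball k).toPair.Iso (B k)) :
    ∃ X : t.Tuple, ∀ k : ℕ, (X.ball k).toPair.Iso (B k) := by
  choose e he using fun k => (hB k).symm
  let i (k : ℕ) : ((ofPair t (B (k + 1))).ball k).toPair.space.Hom (B (k + 1)).space :=
    CompMet.inclSpace _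
  obtain ⟨X, _, o, ⟨E⟩⟩ := exists_exhaustion (t := t)
    (fun k => (i k).comp (CompMet.Hom.ofEquiv (e k)))
    (fun k => congrArg (i k) (congrArg Prod.fst (he k)))
    (fun k => ((e k).surjective.range_comp (i k)).trans Subtype.range_coe)
    (fun k => (t.tmap_comp _ _ _).trans (t.tmap_ofEquiv_of_map_eq (congrArg Prod.snd (he k))))
  exact E.exists_tuple

end PosMetFunctor.Truncation.Tuple

/-! ### Convergence of tuples and of their truncated balls -/

namespace PosMetFunctor.Truncation.Tuple

variable {τ : PosMetFunctor.{u, v}} {t : τ.Truncation} {X Y : t.Tuple} {P Q L L' : τ.pointed.Pair}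
  {r s R ε : ℝ≥0}

theorem isApprox_of_ghf_lt (hsubBall : t.SubtupleApproxBall) (hε : 0 < ε) (hε1 : ε ≤ 1)
    (hR : 1 / ε + ε ≤ R)
    (hX : ((ofPair t P).ball R).toPair.Iso (X.ball R).toPair)
    (hY : ((ofPair t Q).ball R).toPair.Iso (Y.ball R).toPair) (h : P.ghf Q < (ε / 2 : ℝ≥0)) :
    IsApprox ε X Y := by
  have hR' : 1 / ε ≤ R := le_of_add_le_left hR
  have hεR : 1 / ε - ε + 2 * (ε / 2) ≤ 1 / ε := by
    rw [mul_div_cancel₀ _ two_ne_zero,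
      tsub_add_cancel_of_le (hε1.trans ((one_le_div hε).2 hε1))]
  have hXP : (ofPair t P).Between (1 / ε) (X.ball (1 / ε)).toPair :=
    (((ofPair t P).between_ball hR').of_iso hX.symm).comp (X.between_ball hR').ball
  obtain ⟨Q', hQ', hXQ'⟩ := (between_of_iso (.refl Q) _).exists_ghf_lt hsubBall h hXP hεR
  have hQ'R : Q'.Within R := fun x => by
    refine ((within_ball X _).of_ghf_lt hXQ' x).trans ?_
    rw [mul_div_cancel₀ _ two_ne_zero]
    exact NNReal.coe_le_coe.2 hR
  have hle : 1 / ε - ε ≤ R := tsub_le_self.trans hR'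
  exact ⟨Q', ((Y.between_ball hle).of_iso hY).comp (hQ'.fit hQ'R), hXQ'⟩

theorem distance_le_of_ghf_lt (hsubBall : t.SubtupleApproxBall) (hε : 0 < ε) (hR : 1 / ε + ε ≤ R)
    (hX : ((ofPair t P).ball R).toPair.Iso (X.ball R).toPair)
    (hY : ((ofPair t Q).ball R).toPair.Iso (Y.ball R).toPair) (h : P.ghf Q < (ε / 2 : ℝ≥0)) :
    distance X Y ≤ ε := by
  rcases le_total ε 1 with hε1 | hε1
  · exact distance_le hε (isApprox_of_ghf_lt hsubBall hε hε1 hR hX hY h)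
      (isApprox_of_ghf_lt hsubBall hε hε1 hR hY hX ((MetFunctor.Pair.ghf_comm _ _).trans_lt h))
  · exact (distance_le_one X Y).trans hε1

theorem between_of_tendsto_ball (hrigid : τ.Rigid) (hcont : τ.PointwiseContinuous)
    (hsub : t.SubtupleApprox) (hclosed : τ.HausdorffClosed) {l : Filter t.Tuple} [l.NeBot]
    (hrs : r < s) (hsR : s ≤ R) (hL : Tendsto (fun X => (X.ball s).toClass) l (𝓝 L.toClass))
    (hL' : Tendsto (fun X => (X.ball R).toClass) l (𝓝 L'.toClass)) :
    (ofPair t L').Between r L := by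
  refine HasSub.between_of_hasSub_ball hrigid ?_ ?_
  · exact hasSub_of_tendsto hcont hsub hclosed hL' hL
      (.of_forall fun X => (X.between_ball hsR).ball.hasSub)
  choose q hqX hq using fun X : t.Tuple =>
    HasSub.exists_ghf_le hsub ⟨_, ((ofPair t L').ball r).isSubVia⟩ (X.ball R).toPair
  have hlim : Tendsto (fun X => (q X).toClass) l (𝓝 ((ofPair t L').ball r).toPair.toClass) := by
    refine EMetric.tendsto_nhds.2 fun ε hε => ?_
    filter_upwards [EMetric.tendsto_nhds.1 hL' ε hε] with X hX
    exact (edist_comm _ _).trans_lt ((hq X).trans_lt ((edist_comm _ _).trans_lt hX))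
  refine hasSub_of_tendsto hcont hsub hclosed hL hlim ?_
  obtain ⟨η, hη, hηs⟩ : ∃ η : ℝ≥0, 0 < η ∧ r + 2 * η ≤ s :=
    ⟨(s - r) / 2, half_pos (tsub_pos_of_lt hrs), by
      rw [mul_div_cancel₀ _ two_ne_zero, add_tsub_cancel_of_le hrs.le]⟩
  filter_upwards [EMetric.tendsto_nhds.1 hlim η (ENNReal.coe_pos.2 hη)] with X hX
  have hqs : (q X).Within s := fun x =>
    ((within_ball _ r).of_ghf_lt ((edist_comm _ _).trans_lt hX) x).trans (NNReal.coe_le_coe.2 hηs)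
  exact ((X.between_ball le_rfl).hasSub.comp (hqX X)).fit hqs

theorem exists_tendsto_distance (hrigid : τ.Rigid) (hcont : τ.PointwiseContinuous)
    (hsub : t.SubtupleApprox) (hsubBall : t.SubtupleApproxBall) (hclosed : τ.HausdorffClosed)
    {l : Filter t.Tuple} [l.NeBot] {L : ℕ → τ.pointed.Pair}
    (hL : ∀ k : ℕ, Tendsto (fun X => (X.ball (k + 1)).toClass) l (𝓝 (L k).toClass)) :
    ∃ X : t.Tuple, Tendsto (fun Y => distance Y X) l (𝓝 0) := by
  have hiso (k : ℕ) : ((ofPair t (L (k + 1))).ball k).toPair.Iso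
      ((ofPair t (L k)).ball k).toPair := by
    refine (Between.ball_iso ?_).symm
    refine between_of_tendsto_ball (s := k + 1) (R := k + 1 + 1) hrigid hcont hsub hclosed
      (lt_add_of_pos_right _ one_pos) (le_add_of_nonneg_right zero_le_one) (hL k) ?_
    exact_mod_cast hL (k + 1)
  obtain ⟨X, hX⟩ := exists_tuple_of_ball_iso
    (B := fun k => ((ofPair t (L k)).ball k).toPair) fun k => by
      refine (Between.ball_iso ?_).trans (hiso k)
      exact between_ball _ (by exact_mod_cast k.le_succ)
  refine ⟨X, tendsto_order.2 ⟨fun _ h => absurd h not_lt_zero, fun ε hε => ?_⟩⟩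
  obtain ⟨δ, hδ, hδε⟩ := exists_between hε
  obtain ⟨k, hk⟩ := exists_nat_ge (1 / δ + δ)
  filter_upwards [EMetric.tendsto_nhds.1 (hL k) (δ / 2 : ℝ≥0) (ENNReal.coe_pos.2 (half_pos hδ))]
    with Y hY
  refine (distance_le_of_ghf_lt hsubBall hδ hk ?_ (hX k).symm hY).trans_lt hδε
  exact (Y.between_ball (le_add_of_nonneg_right zero_le_one)).ball_iso

theorem exists_hasSub_ghf_lt (hsub : t.SubtupleApprox) (hε : ε ≤ 1 / (r + 1))
    (h : distance Y X < ε) :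
    ∃ Q, (ofPair t (X.ball (r + 1)).toPair).HasSub Q ∧ (Y.ball r).toPair.ghf Q < ε := by
  have hr1 : 1 ≤ r + 1 := le_add_self
  have hε1 : ε ≤ 1 := hε.trans (div_le_one_of_le₀ hr1 zero_le)
  obtain ⟨δ, hδ, hδε, ⟨P, hP, hYP⟩, -⟩ := exists_isApprox_of_distance_lt hε1 h
  have hrδ : r + 1 ≤ 1 / δ := by
    rw [le_div_comm₀ (zero_lt_one.trans_le hr1) hδ]
    exact hδε.le.trans hε
  obtain ⟨Q, hPQ, hQ⟩ := HasSub.exists_ghf_le hsub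
    (Y.between_ball ((le_add_of_nonneg_right zero_le_one).trans hrδ)).ball.hasSub P
  have hYQ : (Y.ball r).toPair.ghf Q < (δ / 2 : ℝ≥0) := hQ.trans_lt hYP
  refine ⟨Q, (hP.hasSub.comp hPQ).fit fun x => ((within_ball Y r).of_ghf_lt hYQ x).trans ?_,
    hYQ.trans_le (ENNReal.coe_le_coe.2 ((half_le_self δ.2).trans hδε.le))⟩
  rw [mul_div_cancel₀ _ two_ne_zero]
  exact NNReal.coe_le_coe.2 (add_le_add_right (hδε.le.trans hε1) r)

theorem exists_tendsto_ball (hsub : t.SubtupleApprox) (hclosed : τ.HausdorffClosed)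
    {V : Ultrafilter t.Tuple} (hX : Tendsto (fun Y => distance Y X) (V : Filter t.Tuple) (𝓝 0))
    (r : ℝ≥0) :
    ∃ c, Tendsto (fun Y => (Y.ball r).toClass) (V : Filter t.Tuple) (𝓝 c) := by
  refine exists_le_nhds_of_forall_thickening_mem (U := V.map fun Y => (Y.ball r).toClass)
    (Sub.isCompact_range_toClass (t := t) (P := (X.ball (r + 1)).toPair) hclosed) fun δ hδ => ?_
  let ε : ℝ≥0 := min (1 / (r + 1)) δ.toNNReal
  have hε : 0 < ε := lt_min (by positivity) (Real.toNNReal_pos.2 hδ)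
  refine Ultrafilter.mem_map.2 ?_
  filter_upwards [hX.eventually_lt_const hε] with Y hY
  obtain ⟨Q, hQ, hYQ⟩ := exists_hasSub_ghf_lt hsub (min_le_left _ _) hY
  obtain ⟨S, hS⟩ := hasSub_iff.1 hQ
  refine (Metric.mem_thickening_iff_exists_edist_lt _ _).2 ⟨S.toClass, ⟨S, rfl⟩, ?_⟩
  calc (Y.ball r).toPair.ghf S.toPair = (Y.ball r).toPair.ghf Q :=
        (MetFunctor.Pair.ghf_congr (.refl _) hS).symm
    _ < ε := hYQ
    _ ≤ ENNReal.ofReal δ := ENNReal.coe_le_coe.2 (min_le_right _ _)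

theorem exists_tendsto_distance_iff (hrigid : τ.Rigid) (hcont : τ.PointwiseContinuous)
    (hsub : t.SubtupleApprox) (hsubBall : t.SubtupleApproxBall) (hclosed : τ.HausdorffClosed)
    (V : Ultrafilter t.Tuple) :
    (∃ X : t.Tuple, Tendsto (fun Y => distance Y X) (V : Filter t.Tuple) (𝓝 0)) ↔
      ∀ r : ℝ≥0, ∃ c, Tendsto (fun Y => (Y.ball r).toClass) (V : Filter t.Tuple) (𝓝 c) := by
  refine ⟨fun ⟨X, hX⟩ => exists_tendsto_ball hsub hclosed hX, fun h => ?_⟩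
  choose c hc using h
  choose L hL using fun k : ℕ => Quotient.mk_surjective (c (k + 1))
  exact exists_tendsto_distance hrigid hcont hsub hsubBall hclosed fun k =>
    (hc (k + 1)).trans_eq (congrArg 𝓝 (hL k).symm)

end PosMetFunctor.Truncation.Tuple

theorem theorem4p6 (τ : PosMetFunctor.{u, v}) (t : τ.Truncation)
    (hrigid : τ.Rigid) (hcont : τ.PointwiseContinuous)
    (hsub : t.SubtupleApprox) (hsubBall : t.SubtupleApproxBall) (hclosed : τ.HausdorffClosed)
    (A : Set t.Classes) :
    IsRelCompactDist (fun x y : t.Classes => (x.distance y : ℝ≥0∞)) A ↔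
      ∀ r : ℝ≥0, IsRelCompactDist (MetFunctor.Classes.ghf (F := τ.pointed))
        (PosMetFunctor.Truncation.ballClasses A r) := by
  let _ : PseudoEMetricSpace t.Classes :=
    PosMetFunctor.Truncation.Classes.pseudoEMetricSpace hsubBall
  let mk : t.Tuple → t.Classes := PosMetFunctor.Truncation.Tuple.toClass
  have hmk : mk '' (mk ⁻¹' A) = A := image_preimage_eq A Quotient.mk_surjective
  have hlim (l : Filter t.Tuple) : (∃ x, Tendsto mk l (𝓝 x)) ↔
      ∃ X : t.Tuple, Tendsto (fun Y => PosMetFunctor.Truncation.Tuple.distance Y X) l (𝓝 0) :=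
    Quotient.mk_surjective.exists.trans <| exists_congr fun X =>
      tendsto_iff_edist_tendsto_0.trans ENNReal.tendsto_coe
  calc IsRelCompactDist edist A
    _ ↔ IsCompact (closure (mk '' (mk ⁻¹' A))) := by rw [hmk, isRelCompactDist_edist]
    _ ↔ ∀ V : Ultrafilter t.Tuple, mk ⁻¹' A ∈ V → ∃ x, Tendsto mk V (𝓝 x) :=
      isCompact_closure_image_iff_ultrafilter
    _ ↔ ∀ V : Ultrafilter t.Tuple, mk ⁻¹' A ∈ V → ∀ r : ℝ≥0, ∃ c,
          Tendsto (fun X => (X.ball r).toClass) (V : Filter t.Tuple) (𝓝 c) :=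
      forall₂_congr fun V _ => (hlim V).trans <|
        PosMetFunctor.Truncation.Tuple.exists_tendsto_distance_iff
          hrigid hcont hsub hsubBall hclosed V
    _ ↔ ∀ (r : ℝ≥0) (V : Ultrafilter t.Tuple), mk ⁻¹' A ∈ V → ∃ c,
          Tendsto (fun X => (X.ball r).toClass) (V : Filter t.Tuple) (𝓝 c) :=
      ⟨fun h r V hV => h V hV r, fun h V hV r => h r V hV⟩
    _ ↔ _ := forall_congr' fun r =>
      isCompact_closure_image_iff_ultrafilter.symm.trans isRelCompactDist_edist.symm
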